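/- Models. A model of set theory is a transitive class $V$ (possibly a set) of the background universe with $(V,\in)\models\mathrm{ZFC}$. Notions prefixed by "in $V$" are relativized to $V$: the subsets and functions they mention range over $V$. Distance monoids. A distance monoid is a structure $\mathcal W=\langle W,+,0,\le\rangle$ where $\langle W,+,0\rangle$ is a commutative monoid, $\le$ is a linear order with least element $0$, addition is monotone in each argument, and $b+\bigwedge A=\bigwedge_{a\in A}(a+b)$ for all $b\in W$ and $A\subseteq W$ for which $\bigwedge A$ exists. Put $W^{+}=W\setminus\{0\}$. $\mathcal W$ is complete if every subset of $W$ has an infimum and a supremum, and continuous if it is complete and $\bigwedge_{a,b\in W^{+}}(a+b)=0$. The coinitiality of $\mathcal W$ is the least ordinal $\alpha$ for which there is a map $s:\alpha\to W^{+}$ with $s(j)\le s(i)$ for $i\le j$ and such that every $a\in W^{+}$ satisfies $s(i)\le a$ for some $i<\alpha$. A completion of $\mathcal W$ is a distance monoid whose order is the Dedekind–MacNeille completion of $\langle W,\le\rangle$, with the same $0$, and whose addition extends that of $\mathcal W$. Generalized dynamical systems. A $\mathcal W$-metric space is a set $M$ with $d:M\times M\to W$ such that $d(x,y)=d(y,x)=0$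 if and only if $x=y$, and $d(x,z)\le d(x,y)+d(y,z)$. A Cauchy sequence on it is a map $p:A\to M$ with $A\subseteq W^{+}$, $\bigwedge_{a,b\in A}(a+b)=0$ and $d(p(a),p(b))\le a+b$ for all $a,b\in A$; it converges to $x\in M$ if $\bigvee_{a\in W^{+}}\bigwedge_{b\in A,\,b\le a}d(x,p(b))=0$ and $\bigvee_{a\in W^{+}}\bigwedge_{b\in A,\,b\le a}d(p(b),x)=0$. A generalized dynamical system is a triple $(\mathcal M,f,\mathcal W)$ where $\mathcal W$ is a complete distance monoid, $\mathcal M$ is a $\mathcal W$-metric space in which every Cauchy sequence converges, and $f:M\to M$ is non-expanding, i.e. $d(f(x),f(y))\le d(x,y)$. It is a two-sorted structure (with $+,0,\le,d,f$), and it has a fixed point if $f(x)=x$ for some $x\in M$. Theorem. Let $V_0\subseteq V_1$ be models of set theory and let $(\mathcal M_0,f_0,\mathcal W_0)\in V_0$ be, in $V_0$, a generalized dynamical system such that, in $V_0$, $\mathcal W_0$ is continuous with coinitiality $\omega$. Let $(\mathcal M_1,f_1,\mathcal W_1)\in V_1$ be its relativization to $V_1$, in either of the following senses: 1. (completion) in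 $V_1$, $(\mathcal M_1,f_1,\mathcal W_1)$ is a generalized dynamical system containing $(\mathcal M_0,f_0,\mathcal W_0)$ as a substructure, $\mathcal W_1$ is a completion of $\mathcal W_0$, and $\mathcal M_1$ is the Cauchy completion of $\mathcal M_0$, i.e. every point of $M_1$ lies in $M_0$ or is the limit of a Cauchy sequence of points of $M_0$; or 2. (minimality) (a) in $V_1$, $(\mathcal M_1,f_1,\mathcal W_1)$ is a generalized dynamical system; (b) $M_0\subseteq M_1$, $W_0\subseteq W_1$ and the identity is a homomorphism; (c) in $V_1$, every embedding of $(\mathcal M_1,f_1,\mathcal W_1)$ into itself that is the identity on $M_0$ and $W_0$ is an automorphism; (d) for every $(\mathcal M^*,f^*,\mathcal W^*)\in V_1$ satisfying (a) and (b) there is in $V_1$ a homomorphism from $(\mathcal M_1,f_1,\mathcal W_1)$ to it that is the identity on $M_0$ and $W_0$. Then $(\mathcal M_0,f_0)$ has a fixed point if and only if $(\mathcal M_1,f_1)$ has a fixed point. -/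

import Mathlib

universe u

/-! ### Transitive models of ZFC -/

/-- The only symbol of the language of set theory: a binary relation. -/
inductive MemSymbol : ℕ → Type
  | mem : MemSymbol 2

/-- The first-order language of set theory. -/
def setLang : FirstOrder.Language.{0, 0} := ⟨fun _ => Empty, MemSymbol⟩

/-- A class `V` of sets, as the structure `(V, ∈)`. -/
instance setStructure (V : Set ZFSet.{u}) : setLang.Structure V where
  funMap := fun f _ => Empty.elim f
  RelMap := fun r x =>
    match r, x with
    | MemSymbol.mem, x => (x 0 : ZFSet.{u}) ∈ (x 1 : ZFSet.{u})

/-- `(V, ∈) ⊨ ZFC` for a transitive class `V` of sets. All quantifiers range over `V`; separation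
and replacement are schemes over the first-order formulas with parameters from `V`. -/
structure IsTransitiveModelZFC (V : Set ZFSet.{u}) : Prop where
  transitive : ∀ x ∈ V, ∀ y ∈ x, y ∈ V
  extensionality : ∀ x y : V, (∀ z : V, z.1 ∈ x.1 ↔ z.1 ∈ y.1) → x = y
  foundation : ∀ x : V, (∃ y : V, y.1 ∈ x.1) →
    ∃ y : V, y.1 ∈ x.1 ∧ ∀ z : V, z.1 ∈ x.1 → z.1 ∉ y.1
  pairing : ∀ x y : V, ∃ z : V, ∀ w : V, w.1 ∈ z.1 ↔ w = x ∨ w = y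
  union : ∀ x : V, ∃ z : V, ∀ w : V, w.1 ∈ z.1 ↔ ∃ y : V, y.1 ∈ x.1 ∧ w.1 ∈ y.1
  powerset : ∀ x : V, ∃ z : V, ∀ w : V, w.1 ∈ z.1 ↔ ∀ t : V, t.1 ∈ w.1 → t.1 ∈ x.1
  infinity : ∃ z : V, (∃ e : V, (∀ t : V, t.1 ∉ e.1) ∧ e.1 ∈ z.1) ∧
    ∀ x : V, x.1 ∈ z.1 → ∃ s : V, (∀ t : V, t.1 ∈ s.1 ↔ t.1 ∈ x.1 ∨ t = x) ∧ s.1 ∈ z.1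
  separation : ∀ (n : ℕ) (φ : setLang.Formula (Fin (n + 1))) (p : Fin n → V) (a : V),
    ∃ b : V, ∀ x : V, x.1 ∈ b.1 ↔ x.1 ∈ a.1 ∧ φ.Realize (Matrix.vecCons x p)
  replacement : ∀ (n : ℕ) (φ : setLang.Formula (Fin (n + 2))) (p : Fin n → V) (a : V),
    (∀ x : V, x.1 ∈ a.1 → ∃! y : V, φ.Realize (Matrix.vecCons x (Matrix.vecCons y p))) →
    ∃ b : V, ∀ y : V, y.1 ∈ b.1 ↔
      ∃ x : V, x.1 ∈ a.1 ∧ φ.Realize (Matrix.vecCons x (Matrix.vecCons y p))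
  choice : ∀ a : V, (∀ x : V, x.1 ∈ a.1 → ∃ z : V, z.1 ∈ x.1) →
    (∀ x y : V, x.1 ∈ a.1 → y.1 ∈ a.1 → (∃ z : V, z.1 ∈ x.1 ∧ z.1 ∈ y.1) → x = y) →
    ∃ c : V, ∀ x : V, x.1 ∈ a.1 → ∃! z : V, z.1 ∈ x.1 ∧ z.1 ∈ c.1

open Classical in
/-- The value of the set-theoretic function `f` at `x` (a junk value outside the domain). -/
noncomputable def setApp (f x : ZFSet.{u}) : ZFSet.{u} :=
  if h : ∃ y, ZFSet.pair x y ∈ f then h.choose else ∅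

/-! ### Distance monoids

Every notion below that quantifies over subsets or functions takes the model `V` as an argument
and lets these range over `V` only: it is the relativization of the notion to `V`. -/

/-- The data of a structure `⟨W, +, 0, ≤⟩`, all of it sets; `add` and `le` are sets of pairs. -/
structure DMon where
  carrier : ZFSet.{u}
  add : ZFSet.{u}
  zero : ZFSet.{u}
  le : ZFSet.{u}

namespace DMon

variable (V : Set ZFSet.{u}) (W : DMon.{u})

/-- `a + b`. -/
noncomputable def plus (a b : ZFSet.{u}) : ZFSet.{u} := setApp W.add (ZFSet.pair a b)

/-- `a ≤ b`. -/
def Le (a b : ZFSet.{u}) : Prop := ZFSet.pair a b ∈ W.le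

/-- The set of the nonzero elements. -/
noncomputable def pos : ZFSet.{u} := ZFSet.sep (fun a => a ≠ W.zero) W.carrier

/-- `g = ⋀ A` in `W`. -/
def IsMeet (A : Set ZFSet.{u}) (g : ZFSet.{u}) : Prop :=
  g ∈ W.carrier ∧ (∀ a ∈ A, W.Le g a) ∧ ∀ h ∈ W.carrier, (∀ a ∈ A, W.Le h a) → W.Le h g

/-- `g = ⋁ A` in `W`. -/
def IsJoin (A : Set ZFSet.{u}) (g : ZFSet.{u}) : Prop :=
  g ∈ W.carrier ∧ (∀ a ∈ A, W.Le a g) ∧ ∀ h ∈ W.carrier, (∀ a ∈ A, W.Le a h) → W.Le g h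

/-- `W ∈ V` and `V ⊨ W` is a distance monoid. -/
structure IsDistanceMonoid : Prop where
  carrier_mem : W.carrier ∈ V
  add_mem : W.add ∈ V
  zero_mem : W.zero ∈ V
  le_mem : W.le ∈ V
  add_isFunc : ZFSet.IsFunc (W.carrier.prod W.carrier) W.carrier W.add
  zero_mem_carrier : W.zero ∈ W.carrier
  le_subset : W.le ⊆ W.carrier.prod W.carrier
  add_assoc : ∀ a ∈ W.carrier, ∀ b ∈ W.carrier, ∀ c ∈ W.carrier,
    W.plus (W.plus a b) c = W.plus a (W.plus b c)
  add_comm : ∀ a ∈ W.carrier, ∀ b ∈ W.carrier, W.plus a b = W.plus b a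
  zero_add : ∀ a ∈ W.carrier, W.plus W.zero a = a
  le_refl : ∀ a ∈ W.carrier, W.Le a a
  le_antisymm : ∀ a ∈ W.carrier, ∀ b ∈ W.carrier, W.Le a b → W.Le b a → a = b
  le_trans : ∀ a ∈ W.carrier, ∀ b ∈ W.carrier, ∀ c ∈ W.carrier,
    W.Le a b → W.Le b c → W.Le a c
  le_total : ∀ a ∈ W.carrier, ∀ b ∈ W.carrier, W.Le a b ∨ W.Le b a
  zero_le : ∀ a ∈ W.carrier, W.Le W.zero a
  add_le_add : ∀ a ∈ W.carrier, ∀ b ∈ W.carrier, ∀ c ∈ W.carrier,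
    W.Le a b → W.Le (W.plus c a) (W.plus c b) ∧ W.Le (W.plus a c) (W.plus b c)
  add_meet : ∀ A ∈ V, A ⊆ W.carrier → ∀ b ∈ W.carrier, ∀ g, W.IsMeet {a | a ∈ A} g →
    W.IsMeet {x | ∃ a ∈ A, x = W.plus a b} (W.plus b g)

/-- `V ⊨ ⟨W, ≤⟩` is complete. -/
def IsComplete : Prop :=
  ∀ A ∈ V, A ⊆ W.carrier → (∃ g, W.IsMeet {a | a ∈ A} g) ∧ ∃ g, W.IsJoin {a | a ∈ A} g

/-- `0 = ⋀ {a + b | a, b ≠ 0}`. -/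
def IsContinuousAtZero : Prop :=
  W.IsMeet {x | ∃ a ∈ W.pos, ∃ b ∈ W.pos, x = W.plus a b} W.zero

/-- `V ⊨ W` is a continuous distance monoid. -/
def IsContinuous : Prop :=
  W.IsDistanceMonoid V ∧ W.IsComplete V ∧ W.IsContinuousAtZero

/-- `s ∈ V` is an initial sequence in `W` with domain the ordinal `α`. -/
structure IsInitialSeq (α s : ZFSet.{u}) : Prop where
  mem : s ∈ V
  isFunc : ZFSet.IsFunc α W.pos s
  antitone : ∀ i ∈ α, ∀ j ∈ α, i ∈ j → W.Le (setApp s j) (setApp s i)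
  coinitial : ∀ a ∈ W.pos, ∃ i ∈ α, W.Le (setApp s i) a

/-- `V ⊨` the coinitiality of `W` is `κ`, i.e. `κ` is the least ordinal that is the domain of an
initial sequence. -/
def IsCoinitiality (κ : ZFSet.{u}) : Prop :=
  κ.IsOrdinal ∧ (∃ s, W.IsInitialSeq V κ s) ∧ ∀ α ∈ κ, ¬ ∃ s, W.IsInitialSeq V α s

/-- `V ⊨ W'` is a completion of the distance monoid `W`: a distance monoid whose addition extends
that of `W` and whose order is the Dedekind–MacNeille completion of the order of `W` (a complete
linear order in which `W` is both join-dense and meet-dense). -/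
structure IsCompletionOf (W' : DMon.{u}) : Prop where
  isDistanceMonoid : W'.IsDistanceMonoid V
  isComplete : W'.IsComplete V
  subset : W.carrier ⊆ W'.carrier
  zero_eq : W'.zero = W.zero
  plus_eq : ∀ a ∈ W.carrier, ∀ b ∈ W.carrier, W'.plus a b = W.plus a b
  le_iff : ∀ a ∈ W.carrier, ∀ b ∈ W.carrier, W'.Le a b ↔ W.Le a b
  join_dense : ∀ x ∈ W'.carrier, W'.IsJoin {a | a ∈ W.carrier ∧ W'.Le a x} x
  meet_dense : ∀ x ∈ W'.carrier, W'.IsMeet {a | a ∈ W.carrier ∧ W'.Le x a} x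

end DMon

/-! ### Generalized dynamical systems -/

/-- The data of a structure `(M, f, W)`: a structure `W` as above, a set `M` of points, a distance
function `M × M → W` and a map `M → M`, all of it sets. -/
structure GDS extends DMon.{u} where
  pts : ZFSet.{u}
  dist : ZFSet.{u}
  map : ZFSet.{u}

namespace GDS

variable (V : Set ZFSet.{u}) (S : GDS.{u})

/-- The distance from `x` to `y`. -/
noncomputable def d (x y : ZFSet.{u}) : ZFSet.{u} := setApp S.dist (ZFSet.pair x y)

/-- `f(x)`. -/
noncomputable def f (x : ZFSet.{u}) : ZFSet.{u} := setApp S.map x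

/-- `M ∈ V` is a `W`-metric space; as `0` is least, `d x y ∨ d y x = 0` says that both are `0`. -/
structure IsMetricSpace : Prop where
  pts_mem : S.pts ∈ V
  dist_mem : S.dist ∈ V
  dist_isFunc : ZFSet.IsFunc (S.pts.prod S.pts) S.carrier S.dist
  eq_iff : ∀ x ∈ S.pts, ∀ y ∈ S.pts, (S.d x y = S.zero ∧ S.d y x = S.zero) ↔ x = y
  triangle : ∀ x ∈ S.pts, ∀ y ∈ S.pts, ∀ z ∈ S.pts,
    S.Le (S.d x z) (S.plus (S.d x y) (S.d y z))

/-- `p ∈ V` is a Cauchy sequence on `M` with domain `A`. -/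
structure IsCauchySeq (A p : ZFSet.{u}) : Prop where
  mem : p ∈ V
  subset : A ⊆ S.pos
  isFunc : ZFSet.IsFunc A S.pts p
  meet_eq : S.IsMeet {x | ∃ a ∈ A, ∃ b ∈ A, x = S.plus a b} S.zero
  cauchy : ∀ a ∈ A, ∀ b ∈ A, S.Le (S.d (setApp p a) (setApp p b)) (S.plus a b)

/-- The sequence `p` with domain `A` converges to `x`:
`⋁_{a ≠ 0} ⋀_{b ≤ a, b ∈ A} d(x, p(b)) = 0` and `⋁_{a ≠ 0} ⋀_{b ≤ a, b ∈ A} d(p(b), x) = 0`. -/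
def ConvergesTo (A p x : ZFSet.{u}) : Prop :=
  S.IsJoin {g | ∃ a ∈ S.pos, S.IsMeet {t | ∃ b ∈ A, S.Le b a ∧ t = S.d x (setApp p b)} g} S.zero ∧
  S.IsJoin {g | ∃ a ∈ S.pos, S.IsMeet {t | ∃ b ∈ A, S.Le b a ∧ t = S.d (setApp p b) x} g} S.zero

/-- `(M, f, W) ∈ V` and `V ⊨ (M, f, W)` is a generalized dynamical system: `W` is a complete
distance monoid, `M` is a Cauchy complete `W`-metric space and `f : M → M` is non-expanding. -/
structure IsGDS : Prop where
  isDistanceMonoid : S.toDMon.IsDistanceMonoid V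
  isComplete : S.toDMon.IsComplete V
  isMetricSpace : S.IsMetricSpace V
  cauchyComplete : ∀ A p, S.IsCauchySeq V A p → ∃ x ∈ S.pts, S.ConvergesTo A p x
  map_mem : S.map ∈ V
  map_isFunc : ZFSet.IsFunc S.pts S.pts S.map
  nonexpanding : ∀ x ∈ S.pts, ∀ y ∈ S.pts, S.Le (S.d (S.f x) (S.f y)) (S.d x y)

/-- The system has a fixed point. -/
def HasFixedPoint : Prop := ∃ x ∈ S.pts, S.f x = x

/-- `S ⊆ N` on both sorts, and the identity is a homomorphism from `S` to `N`. -/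
structure IsSubstructure (N : GDS.{u}) : Prop where
  carrier_subset : S.carrier ⊆ N.carrier
  pts_subset : S.pts ⊆ N.pts
  zero_eq : N.zero = S.zero
  plus_eq : ∀ a ∈ S.carrier, ∀ b ∈ S.carrier, N.plus a b = S.plus a b
  le_of_le : ∀ a ∈ S.carrier, ∀ b ∈ S.carrier, S.Le a b → N.Le a b
  d_eq : ∀ x ∈ S.pts, ∀ y ∈ S.pts, N.d x y = S.d x y
  f_eq : ∀ x ∈ S.pts, N.f x = S.f x

/-- `V ⊨ N` is the completion `(M̂, f̂, Ŵ)` of the system `S = (M, f, W)`, up to isomorphism over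
`S`: `N` is a generalized dynamical system that extends `S`, its distance monoid is the completion
of `W`, and its set of points is the Cauchy completion of `M`, i.e. a Cauchy complete space in
which every point is in `M` or is the limit of a Cauchy sequence of points of `M`. -/
structure IsCompletionOf (N : GDS.{u}) : Prop where
  isGDS : N.IsGDS V
  isSubstructure : S.IsSubstructure N
  monoid : S.toDMon.IsCompletionOf V N.toDMon
  dense : ∀ y ∈ N.pts, y ∈ S.pts ∨
    ∃ A p, N.IsCauchySeq V A p ∧ (∀ a ∈ A, setApp p a ∈ S.pts) ∧ N.ConvergesTo A p y

/-- `(i, j)` is a homomorphism from `S` to `N`; `i` acts on distances and `j` on points. -/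
structure IsHom (N : GDS.{u}) (i j : ZFSet.{u}) : Prop where
  isFunc_left : ZFSet.IsFunc S.carrier N.carrier i
  isFunc_right : ZFSet.IsFunc S.pts N.pts j
  zero : setApp i S.zero = N.zero
  plus : ∀ a ∈ S.carrier, ∀ b ∈ S.carrier,
    setApp i (S.plus a b) = N.plus (setApp i a) (setApp i b)
  le : ∀ a ∈ S.carrier, ∀ b ∈ S.carrier, S.Le a b → N.Le (setApp i a) (setApp i b)
  d : ∀ x ∈ S.pts, ∀ y ∈ S.pts, setApp i (S.d x y) = N.d (setApp j x) (setApp j y)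
  f : ∀ x ∈ S.pts, setApp j (S.f x) = N.f (setApp j x)

/-- `(i, j)` is an embedding: an injective homomorphism that reflects the order. -/
structure IsEmbedding (N : GDS.{u}) (i j : ZFSet.{u}) : Prop extends S.IsHom N i j where
  injective_left : ∀ a ∈ S.carrier, ∀ b ∈ S.carrier, setApp i a = setApp i b → a = b
  injective_right : ∀ x ∈ S.pts, ∀ y ∈ S.pts, setApp j x = setApp j y → x = y
  le_of_le : ∀ a ∈ S.carrier, ∀ b ∈ S.carrier, N.Le (setApp i a) (setApp i b) → S.Le a b

/-- `(i, j)` is the identity on both sorts of `S`. -/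
def FixesPointwise (i j : ZFSet.{u}) : Prop :=
  (∀ a ∈ S.carrier, setApp i a = a) ∧ ∀ x ∈ S.pts, setApp j x = x

/-- `N ∈ V` is a relativization of `S` to `V` with respect to the property of being a generalized
dynamical system. -/
structure IsRelativization (N : GDS.{u}) : Prop where
  isGDS : N.IsGDS V
  isSubstructure : S.IsSubstructure N
  rigid : ∀ i ∈ V, ∀ j ∈ V, N.IsEmbedding N i j → S.FixesPointwise i j →
    (∀ b ∈ N.carrier, ∃ a ∈ N.carrier, setApp i a = b) ∧ ∀ y ∈ N.pts, ∃ x ∈ N.pts, setApp j x = y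
  minimal : ∀ N' : GDS.{u}, N'.IsGDS V → S.IsSubstructure N' →
    ∃ i ∈ V, ∃ j ∈ V, N.IsHom N' i j ∧ S.FixesPointwise i j

end GDS

/-! A fixed point of f₀ is one of f₁ because the inclusion is a homomorphism. The content is the
converse, and its proof differs for the two senses of relativization.

Completion. A fixed point x of f₁ may be new, but it is a limit of points of M₀. Fix an ω-sequence s
in V₀ that is coinitial in W₀⁺. In V₀, form the set `approxNodes` of formal balls (a, y), where a is
a value of s and y is a point of M₀ with d(y, f y) and d(f y, y) at most a + a, and relate two balls
by `approxRel` if one is strictly inside the other. Points of M₀ near x give balls that contain x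
with room to spare, and each of these has another one strictly inside it, so the relation is
ill-founded in the universe (`hasFixedPoint_of_approximated`). Accessibility of a node is witnessed
by a collapsing function in V₀, so the inaccessible nodes form a set in V₀ (`sep_not_acc_mem`). Each
of them has an inaccessible node below it, and dependent choice in V₀ yields a branch whose range is
in V₀ (`exists_branch`). Its radii have strictly increasing indices in s, hence are coinitial; the
branch is itself a Cauchy sequence of approximate fixed points, and as W₀ is continuous, its limit
in M₀ is fixed (`hasFixedPoint_of_isCauchySeq`).

Minimality. Minimality maps the relativization homomorphically to every generalized dynamical system
in V₁ that extends the given one, and homomorphisms preserve fixed points. So it suffices to extend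
only the distances: keep M₀ and f₀, and enlarge W₀ to the monoid of its upper sets in V₁
(`upMonoid`). There W₀⁺ becomes a least positive element, so no Cauchy sequences exist and Cauchy
completeness is vacuous (`upSystem_isGDS`).

All sets above have to be members of the models. Separation and replacement are schemes over
formulas; `Dfn` and `DefF` provide a calculus of definable relations and functions that spares
writing these formulas. -/

/-! ### Definability over a class of sets -/

/-- A relation on the class `V` that is definable over `(V, ∈)` with parameters from `V`. -/
def Dfn (V : Set ZFSet.{u}) {n : ℕ} (P : (Fin n → V) → Prop) : Prop :=
  ∃ φ : setLang.Formula (V ⊕ Fin n), ∀ v, φ.Realize (Sum.elim id v) ↔ P v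

/-- A `V`-valued function on the class `V` whose graph is definable with parameters from `V`. -/
def DefF (V : Set ZFSet.{u}) {n : ℕ} (t : (Fin n → V) → ZFSet.{u}) : Prop :=
  (∀ v, t v ∈ V) ∧ Dfn V (fun w : Fin (n + 1) → V => (w 0).1 = t (Fin.tail w))

namespace Dfn

variable {V : Set ZFSet.{u}} {n m : ℕ} {P Q : (Fin n → V) → Prop}

theorem congr (hP : Dfn V P) (h : ∀ v, P v ↔ Q v) : Dfn V Q := by
  obtain ⟨φ, hφ⟩ := hP
  exact ⟨φ, fun v => (hφ v).trans (h v)⟩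

theorem not (hP : Dfn V P) : Dfn V (fun v => ¬ P v) := by
  obtain ⟨φ, hφ⟩ := hP
  exact ⟨φ.not, fun v => by rw [FirstOrder.Language.Formula.realize_not, hφ]⟩

theorem and (hP : Dfn V P) (hQ : Dfn V Q) : Dfn V (fun v => P v ∧ Q v) := by
  obtain ⟨φ, hφ⟩ := hP
  obtain ⟨ψ, hψ⟩ := hQ
  exact ⟨φ ⊓ ψ, fun v => by rw [FirstOrder.Language.Formula.realize_inf, hφ, hψ]⟩

theorem or (hP : Dfn V P) (hQ : Dfn V Q) : Dfn V (fun v => P v ∨ Q v) :=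
  (hP.not.and hQ.not).not.congr fun v => by tauto

theorem imp (hP : Dfn V P) (hQ : Dfn V Q) : Dfn V (fun v => P v → Q v) :=
  (hP.and hQ.not).not.congr fun v => by tauto

theorem iff (hP : Dfn V P) (hQ : Dfn V Q) : Dfn V (fun v => P v ↔ Q v) :=
  ((hP.imp hQ).and (hQ.imp hP)).congr fun v => by tauto

theorem comp (hP : Dfn V P) (σ : Fin n → Fin m) : Dfn V (fun w : Fin m → V => P (w ∘ σ)) := by
  obtain ⟨φ, hφ⟩ := hP
  refine ⟨φ.relabel (Sum.map id σ), fun w => ?_⟩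
  have : (Sum.elim id w : V ⊕ Fin m → V) ∘ Sum.map id σ = Sum.elim id (w ∘ σ) := by
    ext x; cases x <;> rfl
  rw [FirstOrder.Language.Formula.realize_relabel, this, hφ]

theorem tail (hP : Dfn V P) : Dfn V (fun w : Fin (n + 1) → V => P (Fin.tail w)) :=
  hP.comp Fin.succ

/-- The quantified variable gets index 0 and the others are shifted, as for de Bruijn indices. -/
theorem ex {Q : (Fin n → V) → V → Prop}
    (h : Dfn V (fun w : Fin (n + 1) → V => Q (Fin.tail w) (w 0))) :
    Dfn V (fun v => ∃ x, Q v x) := by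
  obtain ⟨φ, hφ⟩ := h
  let g : V ⊕ Fin (n + 1) → (V ⊕ Fin n) ⊕ Unit :=
    Sum.elim (fun a => .inl (.inl a)) (Fin.cases (.inr ()) fun i => .inl (.inr i))
  refine ⟨(φ.relabel g).iExs Unit, fun v => ?_⟩
  have key : ∀ x : Unit → V, (Sum.elim (Sum.elim id v) x : (V ⊕ Fin n) ⊕ Unit → V) ∘ g =
      Sum.elim id (Fin.cons (x ()) v : Fin (n + 1) → V) := by
    intro x
    ext y
    rcases y with a | i
    · rfl
    · refine Fin.cases ?_ (fun i => ?_) i <;> rfl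
  rw [FirstOrder.Language.Formula.realize_iExs]
  have step : ∀ x : Unit → V, (φ.relabel g).Realize (Sum.elim (Sum.elim id v) x) ↔ Q v (x ()) := by
    intro x
    rw [FirstOrder.Language.Formula.realize_relabel, key, hφ]
    rfl
  exact ⟨fun ⟨x, hx⟩ => ⟨x (), (step x).1 hx⟩, fun ⟨x, hx⟩ => ⟨fun _ => x, (step fun _ => x).2 hx⟩⟩

theorem all {Q : (Fin n → V) → V → Prop}
    (h : Dfn V (fun w : Fin (n + 1) → V => Q (Fin.tail w) (w 0))) :
    Dfn V (fun v => ∀ x, Q v x) :=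
  (ex (Q := fun v x => ¬ Q v x) h.not).not.congr fun v => by simp

theorem mem_atom (a b : V ⊕ Fin n) : Dfn V (fun v : Fin n → V =>
    (Sum.elim id v a : V).1 ∈ (Sum.elim id v b : V).1) :=
  ⟨FirstOrder.Language.Relations.formula (L := setLang) (MemSymbol.mem : setLang.Relations 2)
    ![FirstOrder.Language.Term.var a, FirstOrder.Language.Term.var b],
    fun _ => FirstOrder.Language.Formula.realize_rel⟩

theorem eq_atom (a b : V ⊕ Fin n) : Dfn V (fun v : Fin n → V =>
    (Sum.elim id v a : V).1 = (Sum.elim id v b : V).1) :=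
  ⟨FirstOrder.Language.Term.equal (FirstOrder.Language.Term.var a)
    (FirstOrder.Language.Term.var b),
    fun v => by rw [FirstOrder.Language.Formula.realize_equal]; exact Subtype.ext_iff⟩

/-- The language has no function symbols, so terms are eliminated through their graphs; the value
can be quantified over V because `DefF` places it there. -/
theorem subst {Q : (Fin n → V) → ZFSet.{u} → Prop} {t : (Fin n → V) → ZFSet.{u}}
    (h : Dfn V (fun w : Fin (n + 1) → V => Q (Fin.tail w) (w 0).1)) (ht : DefF V t) :
    Dfn V (fun v => Q v (t v)) :=
  (ex (Q := fun v x => x.1 = t v ∧ Q v x.1) (ht.2.and h)).congr fun v =>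
    ⟨fun ⟨_, hx, hq⟩ => hx ▸ hq, fun hq => ⟨⟨t v, ht.1 v⟩, rfl, hq⟩⟩

end Dfn

namespace DefF

variable {V : Set ZFSet.{u}} {n m : ℕ} {s t : (Fin n → V) → ZFSet.{u}}

theorem var (i : Fin n) : DefF V (fun v : Fin n → V => (v i).1) :=
  ⟨fun v => (v i).2, Dfn.eq_atom (.inr 0) (.inr i.succ)⟩

theorem const {c : ZFSet.{u}} (hc : c ∈ V) : DefF V (fun _ : Fin n → V => c) :=
  ⟨fun _ => hc, Dfn.eq_atom (.inr 0) (.inl ⟨c, hc⟩)⟩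

theorem tail (ht : DefF V t) : DefF V (fun w : Fin (n + 1) → V => t (Fin.tail w)) :=
  -- In the graph, index 0 is the value; the new variable has index 1 and is skipped.
  ⟨fun _ => ht.1 _, ht.2.comp (Fin.cases 0 fun i => i.succ.succ)⟩

theorem congr (hs : DefF V s) (h : ∀ v, s v = t v) : DefF V t :=
  (funext h : s = t) ▸ hs

end DefF

namespace Dfn

variable {V : Set ZFSet.{u}} {n : ℕ} {s t : (Fin n → V) → ZFSet.{u}}

theorem eq (hs : DefF V s) (ht : DefF V t) : Dfn V (fun v => s v = t v) :=
  subst (Q := fun v x => x = t v) ht.2 hs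

theorem mem (hs : DefF V s) (ht : DefF V t) : Dfn V (fun v => s v ∈ t v) :=
  subst (Q := fun v x => x ∈ t v)
    (subst (Q := fun w y => (w 0).1 ∈ y) (mem_atom (.inr 1) (.inr 0)) ht.tail) hs

theorem exV {Q : (Fin n → V) → ZFSet.{u} → Prop}
    (h : Dfn V (fun w : Fin (n + 1) → V => Q (Fin.tail w) (w 0).1)) :
    Dfn V (fun v => ∃ x ∈ V, Q v x) :=
  (ex (Q := fun v x => Q v x.1) h).congr fun v => by simp

theorem allV {Q : (Fin n → V) → ZFSet.{u} → Prop}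
    (h : Dfn V (fun w : Fin (n + 1) → V => Q (Fin.tail w) (w 0).1)) :
    Dfn V (fun v => ∀ x ∈ V, Q v x) :=
  (all (Q := fun v x => Q v x.1) h).congr fun v => by simp

end Dfn

/-- Only finitely many of the parameters occur in a formula. -/
theorem exists_finite_parameters {V : Set ZFSet.{u}} [Nonempty V] {k : ℕ}
    (φ : setLang.Formula (V ⊕ Fin k)) :
    ∃ (n : ℕ) (p : Fin n → V) (ψ : setLang.Formula (Fin k ⊕ Fin n)),
      ∀ v, ψ.Realize (Sum.elim v p) ↔ φ.Realize (Sum.elim id v) := by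
  classical
  let F := φ.freeVarFinset
  let e := F.equivFin
  let d : V := Classical.arbitrary V
  let f : F → Fin k ⊕ Fin F.card := fun a => Sum.elim (fun _ => .inr (e a)) .inl a.1
  let p : Fin F.card → V := fun i => Sum.elim id (fun _ => d) (e.symm i).1
  refine ⟨F.card, p, φ.restrictFreeVar f, fun v => ?_⟩
  refine FirstOrder.Language.BoundedFormula.realize_restrictFreeVar _ ?_
  rintro ⟨a | i, ha⟩
  · change p (e ⟨.inl a, ha⟩) = a
    simp [p]
  · rfl

/-! ### Closure of a transitive model under elementary set operations. -/

namespace IsTransitiveModelZFC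

variable {V : Set ZFSet.{u}} {n : ℕ}

theorem mem_of_mem (hV : IsTransitiveModelZFC V) {x y : ZFSet.{u}} (hy : y ∈ x) (hx : x ∈ V) :
    y ∈ V :=
  hV.transitive x hx y hy

theorem nonempty (hV : IsTransitiveModelZFC V) : Nonempty V :=
  let ⟨z, _⟩ := hV.infinity
  ⟨z⟩

theorem empty_mem (hV : IsTransitiveModelZFC V) : ∅ ∈ V := by
  obtain ⟨z, ⟨e, he, -⟩, -⟩ := hV.infinity
  have : e.1 = ∅ := by
    ext t
    simp only [ZFSet.notMem_empty, iff_false]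
    exact fun ht => he ⟨t, hV.mem_of_mem ht e.2⟩ ht
  exact this ▸ e.2

/-- By transitivity the set provided by separation in V has only elements of V, so it is the subset
of a formed in the universe. -/
theorem sep_mem (hV : IsTransitiveModelZFC V) {Q : ZFSet.{u} → Prop} {a : ZFSet.{u}} (ha : a ∈ V)
    (h : Dfn V (fun v : Fin 1 → V => Q (v 0).1)) : ZFSet.sep Q a ∈ V := by
  obtain ⟨φ, hφ⟩ := h
  have := hV.nonempty
  obtain ⟨n, p, ψ, hψ⟩ := exists_finite_parameters φ
  obtain ⟨b, hb⟩ := hV.separation n (ψ.relabel (Sum.elim (fun _ => 0) Fin.succ)) p ⟨a, ha⟩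
  have : b.1 = ZFSet.sep Q a := by
    ext x
    rw [ZFSet.mem_sep]
    have key : ∀ x : V, (ψ.relabel (Sum.elim (fun _ => 0) Fin.succ)).Realize
        (Matrix.vecCons x p) ↔ Q x.1 := by
      intro x
      have : (Matrix.vecCons x p ∘ Sum.elim (fun _ => 0) Fin.succ : Fin 1 ⊕ Fin n → V) =
          Sum.elim (fun _ => x) p := by
        ext y; cases y <;> rfl
      rw [FirstOrder.Language.Formula.realize_relabel, this, hψ, hφ]
    constructor
    · intro hx
      have := (hb ⟨x, hV.mem_of_mem hx b.2⟩).1 hx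
      exact ⟨this.1, (key _).1 this.2⟩
    · intro hx
      exact (hb ⟨x, hV.mem_of_mem hx.1 ha⟩).2 ⟨hx.1, (key _).2 hx.2⟩
  exact this ▸ b.2

theorem exists_image (hV : IsTransitiveModelZFC V) {Q : ZFSet.{u} → ZFSet.{u} → Prop}
    {a : ZFSet.{u}} (ha : a ∈ V) (h : Dfn V (fun v : Fin 2 → V => Q (v 0).1 (v 1).1))
    (hQ : ∀ x ∈ a, ∃ y ∈ V, Q x y ∧ ∀ z ∈ V, Q x z → z = y) :
    ∃ b ∈ V, ∀ y, y ∈ b ↔ y ∈ V ∧ ∃ x ∈ a, Q x y := by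
  obtain ⟨φ, hφ⟩ := h
  have := hV.nonempty
  obtain ⟨n, p, ψ, hψ⟩ := exists_finite_parameters φ
  let g : Fin 2 ⊕ Fin n → Fin (n + 2) := Sum.elim ![0, 1] fun i => i.succ.succ
  have key : ∀ x y : V, (ψ.relabel g).Realize (Matrix.vecCons x (Matrix.vecCons y p)) ↔
      Q x.1 y.1 := by
    intro x y
    have : (Matrix.vecCons x (Matrix.vecCons y p) ∘ g : Fin 2 ⊕ Fin n → V) =
        Sum.elim ![x, y] p := by
      ext z
      rcases z with i | i
      · fin_cases i <;> rfl
      · rfl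
    rw [FirstOrder.Language.Formula.realize_relabel, this, hψ, hφ]
    rfl
  obtain ⟨b, hb⟩ := hV.replacement n (ψ.relabel g) p ⟨a, ha⟩ (by
    intro x hx
    obtain ⟨y, hy, hq, hu⟩ := hQ x.1 hx
    exact ⟨⟨y, hy⟩, (key _ _).2 hq, fun z hz => Subtype.ext (hu z.1 z.2 ((key _ _).1 hz))⟩)
  refine ⟨b.1, b.2, fun y => ⟨fun hy => ?_, ?_⟩⟩
  · have hyV := hV.mem_of_mem hy b.2
    obtain ⟨x, hx, hq⟩ := (hb ⟨y, hyV⟩).1 hy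
    exact ⟨hyV, x.1, hx, (key _ _).1 hq⟩
  · rintro ⟨hyV, x, hx, hq⟩
    exact (hb ⟨y, hyV⟩).2 ⟨⟨x, hV.mem_of_mem hx ha⟩, hx, (key _ _).2 hq⟩

theorem upair_mem (hV : IsTransitiveModelZFC V) {a b : ZFSet.{u}} (ha : a ∈ V) (hb : b ∈ V) :
    ({a, b} : ZFSet.{u}) ∈ V := by
  obtain ⟨z, hz⟩ := hV.pairing ⟨a, ha⟩ ⟨b, hb⟩
  have : z.1 = {a, b} := by
    ext t
    rw [ZFSet.mem_pair]
    constructor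
    · intro ht
      simpa [Subtype.ext_iff] using (hz ⟨t, hV.mem_of_mem ht z.2⟩).1 ht
    · rintro (rfl | rfl)
      · exact (hz ⟨t, ha⟩).2 (.inl rfl)
      · exact (hz ⟨t, hb⟩).2 (.inr rfl)
  exact this ▸ z.2

theorem pair_mem (hV : IsTransitiveModelZFC V) {a b : ZFSet.{u}} (ha : a ∈ V) (hb : b ∈ V) :
    ZFSet.pair a b ∈ V := by
  have := hV.upair_mem (hV.upair_mem ha ha) (hV.upair_mem ha hb)
  rwa [ZFSet.pair_eq_singleton] at this

theorem of_pair_mem (hV : IsTransitiveModelZFC V) {a b : ZFSet.{u}} (h : ZFSet.pair a b ∈ V) :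
    a ∈ V ∧ b ∈ V := by
  have : ({a, b} : ZFSet.{u}) ∈ V := hV.mem_of_mem (x := ZFSet.pair a b) (by simp [ZFSet.pair]) h
  exact ⟨hV.mem_of_mem (by simp) this, hV.mem_of_mem (by simp) this⟩

theorem of_pair_mem_mem (hV : IsTransitiveModelZFC V) {a b c : ZFSet.{u}} (hc : c ∈ V)
    (h : ZFSet.pair a b ∈ c) : a ∈ V ∧ b ∈ V :=
  hV.of_pair_mem (hV.mem_of_mem h hc)

theorem sUnion_mem (hV : IsTransitiveModelZFC V) {a : ZFSet.{u}} (ha : a ∈ V) :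
    (ZFSet.sUnion a) ∈ V := by
  obtain ⟨z, hz⟩ := hV.union ⟨a, ha⟩
  have : z.1 = ZFSet.sUnion a := by
    ext t
    rw [ZFSet.mem_sUnion]
    constructor
    · intro ht
      obtain ⟨y, hy, hty⟩ := (hz ⟨t, hV.mem_of_mem ht z.2⟩).1 ht
      exact ⟨y.1, hy, hty⟩
    · rintro ⟨y, hy, hty⟩
      have hyV := hV.mem_of_mem hy ha
      exact (hz ⟨t, hV.mem_of_mem hty hyV⟩).2 ⟨⟨y, hyV⟩, hy, hty⟩
  exact this ▸ z.2

theorem union_mem (hV : IsTransitiveModelZFC V) {a b : ZFSet.{u}} (ha : a ∈ V) (hb : b ∈ V) :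
    a ∪ b ∈ V := by
  rw [← ZFSet.sUnion_pair]
  exact hV.sUnion_mem (hV.upair_mem ha hb)

theorem insert_mem (hV : IsTransitiveModelZFC V) {a b : ZFSet.{u}} (ha : a ∈ V) (hb : b ∈ V) :
    insert a b ∈ V := by
  rw [ZFSet.insert_eq, ← ZFSet.pair_eq_singleton]
  exact hV.union_mem (hV.upair_mem ha ha) hb

theorem exists_powerset (hV : IsTransitiveModelZFC V) {a : ZFSet.{u}} (ha : a ∈ V) :
    ∃ b ∈ V, ∀ x, x ∈ b ↔ x ∈ V ∧ x ⊆ a := by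
  obtain ⟨z, hz⟩ := hV.powerset ⟨a, ha⟩
  refine ⟨z.1, z.2, fun x => ⟨fun hx => ?_, fun ⟨hxV, hx⟩ => ?_⟩⟩
  · have hxV := hV.mem_of_mem hx z.2
    exact ⟨hxV, fun t ht => (hz ⟨x, hxV⟩).1 hx ⟨t, hV.mem_of_mem ht hxV⟩ ht⟩
  · exact (hz ⟨x, hxV⟩).2 fun t ht => hx ht

/-- Testing elements of V is enough by transitivity; this makes pairing definable over V. -/
theorem eq_upair_iff (hV : IsTransitiveModelZFC V) {a b z : ZFSet.{u}} (hz : z ∈ V) (ha : a ∈ V)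
    (hb : b ∈ V) : z = {a, b} ↔ ∀ x ∈ V, x ∈ z ↔ x = a ∨ x = b := by
  constructor
  · rintro rfl x -
    exact ZFSet.mem_pair
  · intro h
    ext x
    rw [ZFSet.mem_pair]
    constructor
    · exact fun hx => (h x (hV.mem_of_mem hx hz)).1 hx
    · rintro (rfl | rfl)
      · exact (h x ha).2 (.inl rfl)
      · exact (h x hb).2 (.inr rfl)

end IsTransitiveModelZFC

namespace DefF

variable {V : Set ZFSet.{u}} {n : ℕ} {s t : (Fin n → V) → ZFSet.{u}}

theorem upair (hV : IsTransitiveModelZFC V) (hs : DefF V s) (ht : DefF V t) :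
    DefF V (fun v => ({s v, t v} : ZFSet.{u})) := by
  refine ⟨fun v => hV.upair_mem (hs.1 v) (ht.1 v), ?_⟩
  refine Dfn.congr (P := fun w => ∀ x ∈ V, x ∈ (w 0).1 ↔ x = s (Fin.tail w) ∨ x = t (Fin.tail w))
    ?_ fun w => (hV.eq_upair_iff (w 0).2 (hs.1 _) (ht.1 _)).symm
  exact Dfn.allV ((Dfn.mem (var 0) (var 1)).iff
    ((Dfn.eq (var 0) hs.tail.tail).or (Dfn.eq (var 0) ht.tail.tail)))

theorem pair (hV : IsTransitiveModelZFC V) (hs : DefF V s) (ht : DefF V t) :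
    DefF V (fun v => ZFSet.pair (s v) (t v)) :=
  (upair hV (upair hV hs hs) (upair hV hs ht)).congr fun v => by
    rw [ZFSet.pair_eq_singleton]; rfl

end DefF

namespace Dfn

variable {V : Set ZFSet.{u}} {n : ℕ} {t : (Fin n → V) → ZFSet.{u}}

theorem exMem (hV : IsTransitiveModelZFC V) {Q : (Fin n → V) → ZFSet.{u} → Prop} (ht : DefF V t)
    (h : Dfn V (fun w : Fin (n + 1) → V => Q (Fin.tail w) (w 0).1)) :
    Dfn V (fun v => ∃ x ∈ t v, Q v x) :=
  (exV (Q := fun v x => x ∈ t v ∧ Q v x) ((mem (.var 0) ht.tail).and h)).congr fun v =>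
    ⟨fun ⟨x, _, hx⟩ => ⟨x, hx⟩, fun ⟨x, hx⟩ => ⟨x, hV.mem_of_mem hx.1 (ht.1 v), hx⟩⟩

theorem allMem (hV : IsTransitiveModelZFC V) {Q : (Fin n → V) → ZFSet.{u} → Prop} (ht : DefF V t)
    (h : Dfn V (fun w : Fin (n + 1) → V => Q (Fin.tail w) (w 0).1)) :
    Dfn V (fun v => ∀ x ∈ t v, Q v x) :=
  (exMem hV (Q := fun v x => ¬ Q v x) ht h.not).not.congr fun v => by simp

end Dfn

/-! ### Set-theoretic functions and products in a model. -/

/-- `f` relates every set to at most one set. -/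
def IsFunctional (f : ZFSet.{u}) : Prop :=
  ∀ x y z, ZFSet.pair x y ∈ f → ZFSet.pair x z ∈ f → y = z

theorem IsFunctional.setApp_eq {f x y : ZFSet.{u}} (hf : IsFunctional f)
    (h : ZFSet.pair x y ∈ f) : setApp f x = y := by
  have hex : ∃ y, ZFSet.pair x y ∈ f := ⟨y, h⟩
  rw [setApp, dif_pos hex]
  exact hf _ _ _ hex.choose_spec h

theorem setApp_eq_empty {f x : ZFSet.{u}} (h : ¬ ∃ y, ZFSet.pair x y ∈ f) : setApp f x = ∅ := by
  rw [setApp, dif_neg h]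

namespace ZFSet.IsFunc

variable {a b f : ZFSet.{u}}

theorem isFunctional (hf : ZFSet.IsFunc a b f) : IsFunctional f := fun x _ _ hy hz =>
  (hf.2 x (ZFSet.pair_mem_prod.1 (hf.1 hy)).1).unique hy hz

theorem setApp_spec (hf : ZFSet.IsFunc a b f) {x : ZFSet.{u}} (hx : x ∈ a) :
    ZFSet.pair x (setApp f x) ∈ f := by
  obtain ⟨y, hy, -⟩ := hf.2 x hx
  rwa [hf.isFunctional.setApp_eq hy]

theorem setApp_mem (hf : ZFSet.IsFunc a b f) {x : ZFSet.{u}} (hx : x ∈ a) : setApp f x ∈ b :=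
  (ZFSet.pair_mem_prod.1 (hf.1 (hf.setApp_spec hx))).2

end ZFSet.IsFunc

theorem DefF.app {V : Set ZFSet.{u}} (hV : IsTransitiveModelZFC V) {n : ℕ}
    {t : (Fin n → V) → ZFSet.{u}} {f : ZFSet.{u}} (hfV : f ∈ V) (hf : IsFunctional f)
    (ht : DefF V t) : DefF V (fun v => setApp f (t v)) := by
  have hmem : ∀ x, setApp f x ∈ V := by
    intro x
    by_cases h : ∃ y, ZFSet.pair x y ∈ f
    · obtain ⟨y, hy⟩ := h
      rw [hf.setApp_eq hy]
      exact (hV.of_pair_mem_mem hfV hy).2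
    · rw [setApp_eq_empty h]
      exact hV.empty_mem
  refine ⟨fun v => hmem _, ?_⟩
  -- The second disjunct accounts for the junk value ∅ of `setApp` outside the domain.
  refine Dfn.congr (P := fun w => ZFSet.pair (t (Fin.tail w)) (w 0).1 ∈ f ∨
    (¬ ∃ y ∈ V, ZFSet.pair (t (Fin.tail w)) y ∈ f) ∧ (w 0).1 = ∅) ?_ fun w => ?_
  · exact (Dfn.mem (.pair hV ht.tail (.var 0)) (.const hfV)).or
      ((Dfn.exV (Dfn.mem (.pair hV ht.tail.tail (.var 0)) (.const hfV))).not.and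
        (Dfn.eq (.var 0) (.const hV.empty_mem)))
  · constructor
    · rintro (h | ⟨h, h'⟩)
      · exact (hf.setApp_eq h).symm
      · exact h'.trans (setApp_eq_empty fun ⟨y, hy⟩ =>
          h ⟨y, (hV.of_pair_mem_mem hfV hy).2, hy⟩).symm
    · intro h
      by_cases h' : ∃ y, ZFSet.pair (t (Fin.tail w)) y ∈ f
      · obtain ⟨y, hy⟩ := h'
        exact .inl (by rwa [h.trans (hf.setApp_eq hy)])
      · exact .inr ⟨fun ⟨y, _, hy⟩ => h' ⟨y, hy⟩, h.trans (setApp_eq_empty h')⟩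

theorem IsTransitiveModelZFC.prod_mem {V : Set ZFSet.{u}} (hV : IsTransitiveModelZFC V)
    {a b : ZFSet.{u}} (ha : a ∈ V) (hb : b ∈ V) : a.prod b ∈ V := by
  obtain ⟨c, hc, hc'⟩ := hV.exists_powerset (hV.union_mem ha hb)
  obtain ⟨e, he, he'⟩ := hV.exists_powerset hc
  -- A Kuratowski pair is a set of subsets of a ∪ b, hence an element of the double power set e
  -- computed in V.
  have : a.prod b = ZFSet.sep (fun z => ∃ x ∈ a, ∃ y ∈ b, z = ZFSet.pair x y) e := by
    ext z
    rw [ZFSet.mem_prod, ZFSet.mem_sep, iff_and_self]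
    rintro ⟨x, hx, y, hy, rfl⟩
    have hxV := hV.mem_of_mem hx ha
    have hyV := hV.mem_of_mem hy hb
    refine (he' _).2 ⟨hV.pair_mem hxV hyV, fun t ht => (hc' _).2 ?_⟩
    refine ⟨hV.mem_of_mem ht (hV.pair_mem hxV hyV), fun r hr => ?_⟩
    simp only [ZFSet.pair, ZFSet.mem_pair] at ht
    rw [ZFSet.mem_union]
    rcases ht with rfl | rfl
    · exact .inl (ZFSet.mem_singleton.1 hr ▸ hx)
    · rcases ZFSet.mem_pair.1 hr with rfl | rfl
      exacts [.inl hx, .inr hy]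
  rw [this]
  exact hV.sep_mem he (.exMem hV (.const ha) (.exMem hV (.const hb)
    (.eq (.var _) (.pair hV (.var _) (.var _)))))

/-! ### Absoluteness of well-foundedness -/

section WellFounded

variable {V : Set ZFSet.{u}} {R X : ZFSet.{u}}

/-- `g` is a collapsing function of the relation `R` on an initial segment of `R`:
`g(v) = {g(w) | w R v}`. -/
def IsCollapse (V : Set ZFSet.{u}) (R g : ZFSet.{u}) : Prop :=
  ∀ v ∈ V, ∀ y ∈ V, ZFSet.pair v y ∈ g →
    (∀ w ∈ V, ZFSet.pair w v ∈ R → ∃ z ∈ V, ZFSet.pair w z ∈ g) ∧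
    ∀ z ∈ V, z ∈ y ↔ ∃ w ∈ V, ZFSet.pair w v ∈ R ∧ ZFSet.pair w z ∈ g

/-- Some collapsing function in `V` maps `x` to `y`. -/
def CollapsesTo (V : Set ZFSet.{u}) (R x y : ZFSet.{u}) : Prop :=
  ∃ g ∈ V, IsCollapse V R g ∧ ZFSet.pair x y ∈ g

theorem CollapsesTo.dfn (hV : IsTransitiveModelZFC V) (hR : R ∈ V) {n : ℕ}
    {s t : (Fin n → V) → ZFSet.{u}} (hs : DefF V s) (ht : DefF V t) :
    Dfn V (fun v => CollapsesTo V R (s v) (t v)) := by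
  refine .exV (.and ?_ (.mem (.pair hV hs.tail ht.tail) (.var _)))
  refine .allV (.allV (.imp (.mem (.pair hV (.var _) (.var _)) (.var _)) (.and ?_ ?_)))
  · exact .allV (.imp (.mem (.pair hV (.var _) (.var _)) (.const hR))
      (.exV (.mem (.pair hV (.var _) (.var _)) (.var _))))
  · exact .allV (.iff (.mem (.var _) (.var _)) (.exV (.and
      (.mem (.pair hV (.var _) (.var _)) (.const hR)) (.mem (.pair hV (.var _) (.var _)) (.var _)))))

theorem CollapsesTo.mem (hV : IsTransitiveModelZFC V) {x y : ZFSet.{u}} (h : CollapsesTo V R x y) :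
    x ∈ V ∧ y ∈ V :=
  let ⟨_, hg, _, hxy⟩ := h
  hV.of_pair_mem_mem hg hxy

/-- A collapsing function turns R into membership, so ∈-induction on the value y gives accessibility
in the universe. No predecessor is missed, since all of them lie in V with R. -/
theorem CollapsesTo.acc (hV : IsTransitiveModelZFC V) (hR : R ∈ V) {x y : ZFSet.{u}}
    (h : CollapsesTo V R x y) : Acc (fun v w => ZFSet.pair v w ∈ R) x := by
  obtain ⟨g, hg, hc, hxy⟩ := h
  induction y using ZFSet.inductionOn generalizing x with
  | h y ih =>
    refine ⟨x, fun w hw => ?_⟩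
    obtain ⟨hx, hy⟩ := hV.of_pair_mem_mem hg hxy
    obtain ⟨h1, h2⟩ := hc x hx y hy hxy
    have hwV := (hV.of_pair_mem_mem hR hw).1
    obtain ⟨z, hz, hwz⟩ := h1 w hwV hw
    exact ih z ((h2 z hz).2 ⟨w, hwV, hw, hwz⟩) hwz

theorem CollapsesTo.unique (hV : IsTransitiveModelZFC V) {x y y' : ZFSet.{u}}
    (hx : Acc (fun v w => ZFSet.pair v w ∈ R) x)
    (h : CollapsesTo V R x y) (h' : CollapsesTo V R x y') : y = y' := by
  induction hx generalizing y y' with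
  | intro x _ ih =>
    have key : ∀ {y y'}, CollapsesTo V R x y → CollapsesTo V R x y' → ∀ z ∈ y, z ∈ y' := by
      rintro y y' ⟨g, hg, hc, hxy⟩ ⟨g', hg', hc', hxy'⟩ z hz
      obtain ⟨hx, hy⟩ := hV.of_pair_mem_mem hg hxy
      obtain ⟨-, hy'⟩ := hV.of_pair_mem_mem hg' hxy'
      obtain ⟨w, hw, hwx, hwz⟩ := ((hc x hx y hy hxy).2 z (hV.mem_of_mem hz hy)).1 hz
      obtain ⟨h1, h2⟩ := hc' x hx y' hy' hxy'
      obtain ⟨z', hz', hwz'⟩ := h1 w hw hwx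
      obtain rfl : z = z' := ih w hwx ⟨g, hg, hc, hwz⟩ ⟨g', hg', hc', hwz'⟩
      exact (h2 z hz').2 ⟨w, hw, hwx, hwz'⟩
    ext z
    exact ⟨key h h' z, key h' h z⟩

/-- Induction on accessibility: the values at the predecessors of x are unique, so replacement in V
collects them into y and the corresponding pairs into g, and (x, y) is added to g. Transitivity of R
makes the predecessors of x an initial segment, so the domain needs no further points. -/
theorem exists_collapsesTo (hV : IsTransitiveModelZFC V) (hR : R ∈ V) (hX : X ∈ V)
    (hRX : R ⊆ X.prod X)
    (htrans : ∀ a b c, ZFSet.pair a b ∈ R → ZFSet.pair b c ∈ R → ZFSet.pair a c ∈ R)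
    {x : ZFSet.{u}} (hx : Acc (fun v w => ZFSet.pair v w ∈ R) x) (hxV : x ∈ V) :
    ∃ y, CollapsesTo V R x y := by
  induction hx with
  | intro x hacc ih =>
    -- Irreflexivity at x ensures that the added pair (x, y) gives no second value at a predecessor
    -- of x.
    have hirr : ZFSet.pair x x ∉ R := fun h => by
      have : ∀ z, Acc (fun v w => ZFSet.pair v w ∈ R) z → ZFSet.pair z z ∉ R := fun z hz => by
        induction hz with
        | intro z _ ih => exact fun h => ih z h h
      exact this x (hacc x h) h
    let a := ZFSet.sep (fun w => ZFSet.pair w x ∈ R) X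
    have ha : a ∈ V := hV.sep_mem hX (.mem (.pair hV (.var _) (.const hxV)) (.const hR))
    have hma : ∀ {w}, w ∈ a ↔ ZFSet.pair w x ∈ R := fun {w} => by
      rw [ZFSet.mem_sep, and_iff_right_iff_imp]
      exact fun h => (ZFSet.pair_mem_prod.1 (hRX h)).1
    have hval : ∀ w ∈ a, ∃ z, CollapsesTo V R w z := fun w hw =>
      ih w (hma.1 hw) (hV.mem_of_mem hw ha)
    have huniq : ∀ w ∈ a, ∀ {z z'}, CollapsesTo V R w z → CollapsesTo V R w z' → z = z' :=
      fun w hw => CollapsesTo.unique hV (hacc w (hma.1 hw))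
    obtain ⟨y, hy, hmy⟩ := hV.exists_image (Q := CollapsesTo V R) ha
      (CollapsesTo.dfn hV hR (.var _) (.var _)) fun w hw =>
        let ⟨z, hz⟩ := hval w hw
        ⟨z, (hz.mem hV).2, hz, fun z' _ hz' => huniq w hw hz' hz⟩
    obtain ⟨g, hg, hmg⟩ := hV.exists_image
      (Q := fun w p => ∃ z ∈ V, CollapsesTo V R w z ∧ p = ZFSet.pair w z) ha
      (.exV (.and (CollapsesTo.dfn hV hR (.var _) (.var _))
        (.eq (.var _) (.pair hV (.var _) (.var _))))) fun w hw => by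
        obtain ⟨z, hz⟩ := hval w hw
        refine ⟨_, hV.pair_mem (hz.mem hV).1 (hz.mem hV).2, ⟨z, (hz.mem hV).2, hz, rfl⟩, ?_⟩
        rintro _ - ⟨z', -, hz', rfl⟩
        rw [huniq w hw hz' hz]
    have hpg : ∀ {w z}, ZFSet.pair w z ∈ g ↔ ZFSet.pair w x ∈ R ∧ CollapsesTo V R w z := by
      intro w z
      rw [hmg]
      constructor
      · rintro ⟨-, w', hw', z', -, hz', he⟩
        obtain ⟨rfl, rfl⟩ := ZFSet.pair_inj.1 he
        exact ⟨hma.1 hw', hz'⟩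
      · rintro ⟨hw, hz⟩
        exact ⟨hV.pair_mem (hz.mem hV).1 (hz.mem hV).2, w, hma.2 hw, z, (hz.mem hV).2, hz, rfl⟩
    have hpg' : ∀ {v w z}, ZFSet.pair w v ∈ R → (v = x ∨ ZFSet.pair v x ∈ R) →
        (ZFSet.pair w z ∈ insert (ZFSet.pair x y) g ↔ CollapsesTo V R w z) := by
      intro v w z hwv hv
      have hwx : ZFSet.pair w x ∈ R := by
        rcases hv with rfl | hv
        exacts [hwv, htrans _ _ _ hwv hv]
      rw [ZFSet.mem_insert_iff, ZFSet.pair_inj, hpg]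
      constructor
      · rintro (⟨rfl, -⟩ | h)
        exacts [absurd hwx hirr, h.2]
      · exact fun h => .inr ⟨hwx, h⟩
    refine ⟨y, insert (ZFSet.pair x y) g, hV.insert_mem (hV.pair_mem hxV hy) hg, ?_,
      ZFSet.mem_insert _ _⟩
    intro v hv y' hy' hvy'
    have hvx : v = x ∨ ZFSet.pair v x ∈ R := by
      rw [ZFSet.mem_insert_iff, ZFSet.pair_inj, hpg] at hvy'
      exact hvy'.imp (·.1) (·.1)
    have hwa : ∀ {w}, ZFSet.pair w v ∈ R → w ∈ a := fun {w} hw => by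
      rcases hvx with rfl | hvx
      exacts [hma.2 hw, hma.2 (htrans _ _ _ hw hvx)]
    refine ⟨fun w hw hwv => ?_, fun z hz => ?_⟩
    · obtain ⟨z, hz⟩ := hval w (hwa hwv)
      exact ⟨z, (hz.mem hV).2, (hpg' hwv hvx).2 hz⟩
    · have : (∃ w ∈ V, ZFSet.pair w v ∈ R ∧ ZFSet.pair w z ∈ insert (ZFSet.pair x y) g) ↔
          ∃ w ∈ V, ZFSet.pair w v ∈ R ∧ CollapsesTo V R w z :=
        exists_congr fun w => and_congr_right fun _ => and_congr_right fun h => hpg' h hvx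
      rw [this]
      rw [ZFSet.mem_insert_iff, ZFSet.pair_inj, hpg] at hvy'
      rcases hvy' with ⟨rfl, rfl⟩ | ⟨-, g', hg', hc, hvy'⟩
      · rw [hmy]
        exact ⟨fun ⟨_, w, hw, h⟩ => ⟨w, hV.mem_of_mem hw ha, hma.1 hw, h⟩,
          fun ⟨w, hw, hwv, h⟩ => ⟨hz, w, hma.2 hwv, h⟩⟩
      · obtain ⟨h1, h2⟩ := hc v hv y' hy' hvy'
        rw [h2 z hz]
        refine exists_congr fun w => and_congr_right fun hw => and_congr_right fun hwv =>
          ⟨fun h => ⟨g', hg', hc, h⟩, fun h => ?_⟩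
        obtain ⟨z', -, hz'⟩ := h1 w hw hwv
        rwa [huniq w (hwa hwv) h ⟨g', hg', hc, hz'⟩]

/-- The well-founded part of a transitive relation is absolute. -/
theorem sep_not_acc_mem (hV : IsTransitiveModelZFC V) (hR : R ∈ V) (hX : X ∈ V)
    (hRX : R ⊆ X.prod X)
    (htrans : ∀ a b c, ZFSet.pair a b ∈ R → ZFSet.pair b c ∈ R → ZFSet.pair a c ∈ R) :
    ZFSet.sep (fun x => ¬ Acc (fun v w => ZFSet.pair v w ∈ R) x) X ∈ V := by
  have : ZFSet.sep (fun x => ¬ Acc (fun v w => ZFSet.pair v w ∈ R) x) X =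
      ZFSet.sep (fun x => ¬ ∃ y ∈ V, CollapsesTo V R x y) X := by
    ext x
    rw [ZFSet.mem_sep, ZFSet.mem_sep]
    refine and_congr_right fun hx => not_congr ⟨fun h => ?_, fun ⟨y, _, hy⟩ => hy.acc hV hR⟩
    obtain ⟨y, hy⟩ := exists_collapsesTo hV hR hX hRX htrans h (hV.mem_of_mem hx hX)
    exact ⟨y, (hy.mem hV).2, hy⟩
  rw [this]
  exact hV.sep_mem hX (.not (.exV (CollapsesTo.dfn hV hR (.var _) (.var _))))

end WellFounded

/-! ### Dependent choice in a model -/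

section DependentChoice

variable {V : Set ZFSet.{u}} {R P : ZFSet.{u}}

/-- Choice is available for disjoint families. It is applied to the sets F x of pairs (x, y) with
(y, x) in R, which the first coordinate keeps disjoint. -/
theorem exists_choice_function (hV : IsTransitiveModelZFC V) (hR : R ∈ V) (hP : P ∈ V)
    (h : ∀ x ∈ P, ∃ y ∈ P, ZFSet.pair y x ∈ R) :
    ∃ C ∈ V, ∀ x ∈ P, ∃ y ∈ P, ZFSet.pair y x ∈ R ∧ ∀ z, ZFSet.pair x z ∈ C ↔ z = y := by
  let T := ZFSet.sep (fun p => ∃ x ∈ P, ∃ y ∈ P, ZFSet.pair y x ∈ R ∧ p = ZFSet.pair x y)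
    (P.prod P)
  have hT : T ∈ V := hV.sep_mem (hV.prod_mem hP hP) (.exMem hV (.const hP) (.exMem hV (.const hP)
    (.and (.mem (.pair hV (.var _) (.var _)) (.const hR))
      (.eq (.var _) (.pair hV (.var _) (.var _))))))
  have hmT : ∀ {x y}, ZFSet.pair x y ∈ T ↔ x ∈ P ∧ y ∈ P ∧ ZFSet.pair y x ∈ R := by
    intro x y
    rw [ZFSet.mem_sep, ZFSet.pair_mem_prod]
    constructor
    · rintro ⟨⟨hx, hy⟩, x', -, y', -, hr, he⟩
      obtain ⟨rfl, rfl⟩ := ZFSet.pair_inj.1 he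
      exact ⟨hx, hy, hr⟩
    · rintro ⟨hx, hy, hr⟩
      exact ⟨⟨hx, hy⟩, x, hx, y, hy, hr, rfl⟩
  let F : ZFSet.{u} → ZFSet.{u} := fun x => ZFSet.sep (fun p => ∃ y ∈ P, p = ZFSet.pair x y) T
  have hF : ∀ x ∈ P, F x ∈ V := fun x hx => hV.sep_mem hT (.exMem hV (.const hP)
    (.eq (.var _) (.pair hV (.const (hV.mem_of_mem hx hP)) (.var _))))
  have hmF : ∀ {x p}, p ∈ F x ↔ x ∈ P ∧ ∃ y ∈ P, ZFSet.pair y x ∈ R ∧ p = ZFSet.pair x y := by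
    intro x p
    rw [ZFSet.mem_sep]
    constructor
    · rintro ⟨hp, y, hy, rfl⟩
      obtain ⟨hx, -, hr⟩ := hmT.1 hp
      exact ⟨hx, y, hy, hr, rfl⟩
    · rintro ⟨hx, y, hy, hr, rfl⟩
      exact ⟨hmT.2 ⟨hx, hy, hr⟩, y, hy, rfl⟩
  obtain ⟨a, ha, hma⟩ := hV.exists_image
    (Q := fun x f => ∀ p ∈ V, p ∈ f ↔ p ∈ T ∧ ∃ y ∈ P, p = ZFSet.pair x y) hP
    (.allV (.iff (.mem (.var _) (.var _)) (.and (.mem (.var _) (.const hT))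
      (.exMem hV (.const hP) (.eq (.var _) (.pair hV (.var _) (.var _))))))) (by
    intro x hx
    refine ⟨F x, hF x hx, fun p _ => ZFSet.mem_sep, fun f hf hf' => ?_⟩
    ext p
    constructor
    · exact fun hp => ZFSet.mem_sep.2 ((hf' p (hV.mem_of_mem hp hf)).1 hp)
    · exact fun hp => (hf' p (hV.mem_of_mem hp (hF x hx))).2 (ZFSet.mem_sep.1 hp))
  have hma' : ∀ {f}, f ∈ a ↔ ∃ x ∈ P, f = F x := by
    intro f
    rw [hma]
    constructor
    · rintro ⟨hf, x, hx, hf'⟩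
      refine ⟨x, hx, ?_⟩
      ext p
      constructor
      · exact fun hp => ZFSet.mem_sep.2 ((hf' p (hV.mem_of_mem hp hf)).1 hp)
      · exact fun hp => (hf' p (hV.mem_of_mem hp (hF x hx))).2 (ZFSet.mem_sep.1 hp)
    · rintro ⟨x, hx, rfl⟩
      exact ⟨hF x hx, x, hx, fun p _ => ZFSet.mem_sep⟩
  obtain ⟨c, hc⟩ := hV.choice ⟨a, ha⟩ (by
    rintro ⟨f, hfV⟩ hf
    obtain ⟨x, hx, rfl⟩ := hma'.1 hf
    obtain ⟨y, hy, hr⟩ := h x hx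
    exact ⟨⟨ZFSet.pair x y, hV.pair_mem (hV.mem_of_mem hx hP) (hV.mem_of_mem hy hP)⟩,
      hmF.2 ⟨hx, y, hy, hr, rfl⟩⟩) (by
    rintro ⟨f, hfV⟩ ⟨f', hfV'⟩ hf hf' ⟨⟨p, hp⟩, hpf, hpf'⟩
    obtain ⟨x, hx, rfl⟩ := hma'.1 hf
    obtain ⟨x', hx', rfl⟩ := hma'.1 hf'
    obtain ⟨-, y, -, -, rfl⟩ := hmF.1 hpf
    obtain ⟨-, y', -, -, he⟩ := hmF.1 hpf'
    obtain ⟨rfl, -⟩ := ZFSet.pair_inj.1 he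
    rfl)
  refine ⟨ZFSet.sep (fun p => p ∈ c.1) T, hV.sep_mem hT (.mem (.var _) (.const c.2)), ?_⟩
  intro x hx
  obtain ⟨⟨p, hpV⟩, ⟨hp, hpc⟩, hpu⟩ := hc ⟨F x, hF x hx⟩ (hma'.2 ⟨x, hx, rfl⟩)
  obtain ⟨-, y, hy, hr, rfl⟩ := hmF.1 hp
  refine ⟨y, hy, hr, fun z => ?_⟩
  rw [ZFSet.mem_sep]
  constructor
  · rintro ⟨hz, hzc⟩
    obtain ⟨-, hzP, hzr⟩ := hmT.1 hz
    have := hpu ⟨ZFSet.pair x z, hV.mem_of_mem hz hT⟩ ⟨hmF.2 ⟨hx, z, hzP, hzr, rfl⟩, hzc⟩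
    exact (ZFSet.pair_inj.1 (Subtype.ext_iff.1 this)).2
  · rintro rfl
    exact ⟨hmT.2 ⟨hx, hy, hr⟩, hpc⟩

/-- Dependent choice in `V`, for a relation along which some index in `ℕ` increases. -/
theorem exists_branch (hV : IsTransitiveModelZFC V) (hR : R ∈ V) (hP : P ∈ V)
    (hne : ∃ x, x ∈ P) (h : ∀ x ∈ P, ∃ y ∈ P, ZFSet.pair y x ∈ R) (idx : ZFSet.{u} → ℕ)
    (hidx : ∀ x ∈ P, ∀ y ∈ P, ZFSet.pair y x ∈ R → idx x < idx y) :
    ∃ O ∈ V, ∃ b : ℕ → ZFSet.{u}, (∀ k, b k ∈ P) ∧ (∀ k, ZFSet.pair (b (k + 1)) (b k) ∈ R) ∧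
      ∀ x, x ∈ O ↔ ∃ k, x = b k := by
  obtain ⟨C, hC, hCP⟩ := exists_choice_function hV hR hP h
  obtain ⟨x₀, hx₀⟩ := hne
  choose! c hcP hcR hcC using hCP
  let b : ℕ → ZFSet.{u} := fun k => c^[k] x₀
  have hb_succ : ∀ k, b (k + 1) = c (b k) := fun k => Function.iterate_succ_apply' c k x₀
  have hbP : ∀ k, b k ∈ P := by
    intro k
    induction k with
    | zero => exact hx₀
    | succ k ih => rw [hb_succ]; exact hcP _ ih
  have hx₀V := hV.mem_of_mem hx₀ hP
  -- The sequence b is built outside V. Its range is defined in V by sets t in which every element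
  -- is x₀ or the C-image of an element of t; tracing back through t lowers `idx`, so it ends at x₀.
  let O := ZFSet.sep (fun x => ∃ t ∈ V, x ∈ t ∧ ∀ y ∈ t, y ∈ P ∧
    (y = x₀ ∨ ∃ z ∈ t, ZFSet.pair z y ∈ C)) P
  refine ⟨O, hV.sep_mem hP (.exV (.and (.mem (.var _) (.var _)) (.allMem hV (.var _)
    (.and (.mem (.var _) (.const hP)) (.or (.eq (.var _) (.const hx₀V))
      (.exMem hV (.var _) (.mem (.pair hV (.var _) (.var _)) (.const hC)))))))), b, hbP,
    fun k => by rw [hb_succ]; exact hcR _ (hbP k), fun x => ?_⟩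
  rw [ZFSet.mem_sep]
  constructor
  · rintro ⟨-, t, -, hxt, ht⟩
    induction hn : idx x using Nat.strong_induction_on generalizing x with
    | h n ih =>
      obtain ⟨hxP, rfl | ⟨z, hz, hzx⟩⟩ := ht x hxt
      · exact ⟨0, rfl⟩
      · have hzP := (ht z hz).1
        obtain rfl := (hcC z hzP x).1 hzx
        obtain ⟨k, rfl⟩ := ih _ (hn ▸ hidx z hzP _ hxP (hcR z hzP)) z hz rfl
        exact ⟨k + 1, (hb_succ k).symm⟩
  · rintro ⟨k, rfl⟩
    refine ⟨hbP k, ?_⟩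
    induction k with
    | zero =>
      refine ⟨{x₀, x₀}, hV.upair_mem hx₀V hx₀V, by simp [b], fun y hy => ?_⟩
      obtain rfl : y = x₀ := by simpa using hy
      exact ⟨hx₀, .inl rfl⟩
    | succ k ih =>
      obtain ⟨t, htV, hkt, ht⟩ := ih
      refine ⟨insert (b (k + 1)) t, hV.insert_mem (hV.mem_of_mem (hbP _) hP) htV,
        ZFSet.mem_insert _ _, fun y hy => ?_⟩
      rcases ZFSet.mem_insert_iff.1 hy with rfl | hy
      · exact ⟨hbP _, .inr ⟨b k, ZFSet.mem_insert_of_mem _ hkt,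
          (hcC _ (hbP k) _).2 (hb_succ k)⟩⟩
      · obtain ⟨hyP, h⟩ := ht y hy
        exact ⟨hyP, h.imp_right fun ⟨z, hz, hzy⟩ => ⟨z, ZFSet.mem_insert_of_mem _ hz, hzy⟩⟩

end DependentChoice

/-! ### The natural numbers as sets -/

/-- The von Neumann natural numbers. -/
noncomputable def natSet : ℕ → ZFSet.{u}
  | 0 => ∅
  | n + 1 => insert (natSet n) (natSet n)

theorem natSet_mem_natSet {m n : ℕ} (h : m < n) : natSet.{u} m ∈ natSet n := by
  induction n with
  | zero => omega
  | succ n ih =>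
    rw [natSet, ZFSet.mem_insert_iff]
    rcases Nat.lt_succ_iff_lt_or_eq.1 h with h | rfl
    exacts [.inr (ih h), .inl rfl]

theorem natSet_mem_omega (n : ℕ) : natSet.{u} n ∈ ZFSet.omega := by
  induction n with
  | zero => exact ZFSet.omega_zero
  | succ n ih => exact ZFSet.omega_succ ih

theorem mem_omega_iff {x : ZFSet.{u}} : x ∈ ZFSet.omega ↔ ∃ n, x = natSet n := by
  refine ⟨fun hx => ?_, fun ⟨n, hn⟩ => hn ▸ natSet_mem_omega n⟩
  have key : ∀ n, ZFSet.mk (PSet.ofNat n) = natSet n := by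
    intro n
    induction n with
    | zero => rfl
    | succ n ih => rw [natSet, ← ih]; rfl
  induction x using Quotient.inductionOn with
  | h x =>
    obtain ⟨⟨n⟩, hn⟩ := hx
    exact ⟨n, (Quotient.sound hn : ZFSet.mk x = ZFSet.mk (PSet.ofNat n)).trans (key n)⟩

/-! ### Distance monoids -/

namespace DMon

variable {V : Set ZFSet.{u}} {W : DMon.{u}} {a b c e : ZFSet.{u}}

theorem mem_pos : a ∈ W.pos ↔ a ∈ W.carrier ∧ a ≠ W.zero := ZFSet.mem_sep

namespace IsDistanceMonoid

theorem plus_mem (h : W.IsDistanceMonoid V) (ha : a ∈ W.carrier) (hb : b ∈ W.carrier) :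
    W.plus a b ∈ W.carrier :=
  h.add_isFunc.setApp_mem (ZFSet.pair_mem_prod.2 ⟨ha, hb⟩)

theorem mem_of_le (h : W.IsDistanceMonoid V) (hab : W.Le a b) :
    a ∈ W.carrier ∧ b ∈ W.carrier :=
  ZFSet.pair_mem_prod.1 (h.le_subset hab)

theorem trans (h : W.IsDistanceMonoid V) (hab : W.Le a b) (hbc : W.Le b c) : W.Le a c :=
  h.le_trans a (h.mem_of_le hab).1 b (h.mem_of_le hab).2 c (h.mem_of_le hbc).2 hab hbc

theorem add_le_add' (h : W.IsDistanceMonoid V) (hab : W.Le a b) (hce : W.Le c e) :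
    W.Le (W.plus a c) (W.plus b e) :=
  have ⟨ha, hb⟩ := h.mem_of_le hab
  have ⟨hc, he⟩ := h.mem_of_le hce
  h.trans (h.add_le_add a ha b hb c hc hab).2 (h.add_le_add c hc e he b hb hce).1

theorem le_add_left (h : W.IsDistanceMonoid V) (ha : a ∈ W.carrier) (hb : b ∈ W.carrier) :
    W.Le a (W.plus b a) := by
  have := (h.add_le_add _ h.zero_mem_carrier b hb a ha (h.zero_le b hb)).2
  rwa [h.zero_add a ha] at this

theorem le_add_right (h : W.IsDistanceMonoid V) (ha : a ∈ W.carrier) (hb : b ∈ W.carrier) :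
    W.Le a (W.plus a b) := by
  rw [h.add_comm a ha b hb]
  exact h.le_add_left ha hb

theorem eq_zero_of_le (h : W.IsDistanceMonoid V) (ha : W.Le a W.zero) : a = W.zero :=
  have hac := (h.mem_of_le ha).1
  h.le_antisymm a hac _ h.zero_mem_carrier ha (h.zero_le a hac)

theorem le_of_not_le (h : W.IsDistanceMonoid V) (ha : a ∈ W.carrier) (hb : b ∈ W.carrier)
    (hab : ¬ W.Le a b) : W.Le b a :=
  (h.le_total a ha b hb).resolve_left hab

/-- If c ≤ e + e for all positive e, then taking e to be the smaller of a and b gives c ≤ a + b for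
all positive a and b, and continuity forces c = 0. The negated inequality makes e + e strictly
smaller than c. -/
theorem exists_half (h : W.IsDistanceMonoid V) (hW : W.IsContinuousAtZero) (hc : c ∈ W.pos) :
    ∃ e ∈ W.pos, ¬ W.Le c (W.plus e e) := by
  by_contra! hcon
  rw [mem_pos] at hc
  refine hc.2 (h.eq_zero_of_le (hW.2.2 c hc.1 ?_))
  rintro _ ⟨a, ha, b, hb, rfl⟩
  have ha' := (mem_pos.1 ha).1
  have hb' := (mem_pos.1 hb).1
  rcases h.le_total a ha' b hb' with hab | hba
  · exact h.trans (hcon a ha) (h.add_le_add' (h.le_refl a ha') hab)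
  · exact h.trans (hcon b hb) (h.add_le_add' hba (h.le_refl b hb'))

theorem exists_add_self_le (h : W.IsDistanceMonoid V) (hW : W.IsContinuousAtZero)
    (hc : c ∈ W.pos) : ∃ e ∈ W.pos, W.Le (W.plus e e) c := by
  obtain ⟨e, he, hce⟩ := h.exists_half hW hc
  have he' := (mem_pos.1 he).1
  exact ⟨e, he, h.le_of_not_le (mem_pos.1 hc).1 (h.plus_mem he' he') hce⟩

theorem dfn_le (h : W.IsDistanceMonoid V) (hV : IsTransitiveModelZFC V) {n : ℕ}
    {s t : (Fin n → V) → ZFSet.{u}} (hs : DefF V s) (ht : DefF V t) :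
    Dfn V (fun v => W.Le (s v) (t v)) :=
  .mem (.pair hV hs ht) (.const h.le_mem)

theorem defF_plus (h : W.IsDistanceMonoid V) (hV : IsTransitiveModelZFC V) {n : ℕ}
    {s t : (Fin n → V) → ZFSet.{u}} (hs : DefF V s) (ht : DefF V t) :
    DefF V (fun v => W.plus (s v) (t v)) :=
  .app hV h.add_mem h.add_isFunc.isFunctional (.pair hV hs ht)

end IsDistanceMonoid

end DMon

/-! ### Convergence -/

namespace GDS

open DMon

variable {V : Set ZFSet.{u}} {S : GDS.{u}}

namespace IsMetricSpace

theorem d_mem (h : S.IsMetricSpace V) {x y : ZFSet.{u}} (hx : x ∈ S.pts) (hy : y ∈ S.pts) :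
    S.d x y ∈ S.carrier :=
  h.dist_isFunc.setApp_mem (ZFSet.pair_mem_prod.2 ⟨hx, hy⟩)

theorem d_self (h : S.IsMetricSpace V) {x : ZFSet.{u}} (hx : x ∈ S.pts) : S.d x x = S.zero :=
  ((h.eq_iff x hx x hx).2 rfl).1

theorem defF_d (h : S.IsMetricSpace V) (hV : IsTransitiveModelZFC V) {n : ℕ}
    {s t : (Fin n → V) → ZFSet.{u}} (hs : DefF V s) (ht : DefF V t) :
    DefF V (fun v => S.d (s v) (t v)) :=
  .app hV h.dist_mem h.dist_isFunc.isFunctional (.pair hV hs ht)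

end IsMetricSpace

namespace IsGDS

theorem f_mem (h : S.IsGDS V) {x : ZFSet.{u}} (hx : x ∈ S.pts) : S.f x ∈ S.pts :=
  h.map_isFunc.setApp_mem hx

theorem defF_f (h : S.IsGDS V) (hV : IsTransitiveModelZFC V) {n : ℕ}
    {s : (Fin n → V) → ZFSet.{u}} (hs : DefF V s) : DefF V (fun v => S.f (s v)) :=
  .app hV h.map_mem h.map_isFunc.isFunctional hs

/-- The join ranges only over those meets that exist, so the meet at a must first be obtained from
completeness in V; this is what definability of F is for. It is below the join, hence 0, so the
positive e cannot lie strictly below all values. -/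
theorem exists_le_of_isJoin_zero (h : S.IsGDS V) (hV : IsTransitiveModelZFC V) {A : ZFSet.{u}}
    (hA : A ∈ V) {F : ZFSet.{u} → ZFSet.{u}} (hF : ∀ b ∈ A, F b ∈ S.carrier)
    (hFdef : ∀ {n : ℕ} {t : (Fin n → V) → ZFSet.{u}}, DefF V t → DefF V (fun v => F (t v)))
    (hj : S.IsJoin {g | ∃ a ∈ S.pos, S.IsMeet {t | ∃ b ∈ A, S.Le b a ∧ t = F b} g} S.zero)
    {a e : ZFSet.{u}} (ha : a ∈ S.pos) (he : e ∈ S.pos) :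
    ∃ b ∈ A, S.Le b a ∧ S.Le (F b) e := by
  have hW := h.isDistanceMonoid
  let B := ZFSet.sep (fun t => ∃ b ∈ A, S.Le b a ∧ t = F b) S.carrier
  have haV := hV.mem_of_mem (mem_pos.1 ha).1 hW.carrier_mem
  have hB : B ∈ V := hV.sep_mem hW.carrier_mem (.exMem hV (.const hA)
    (.and (hW.dfn_le hV (.var _) (.const haV)) (.eq (.var _) (hFdef (.var _)))))
  have hset : {t | t ∈ B} = {t | ∃ b ∈ A, S.Le b a ∧ t = F b} := by
    ext t
    simp only [B, Set.mem_ofPred_eq, ZFSet.mem_sep, and_iff_right_iff_imp]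
    rintro ⟨b, hb, -, rfl⟩
    exact hF b hb
  obtain ⟨g, hg⟩ := (h.isComplete B hB fun t ht => (ZFSet.mem_sep.1 ht).1).1
  rw [hset] at hg
  obtain rfl := hW.eq_zero_of_le (hj.2.1 g ⟨a, ha, hg⟩)
  by_contra! hcon
  rw [mem_pos] at he
  refine he.2 (hW.eq_zero_of_le (hg.2.2 e he.1 ?_))
  rintro _ ⟨b, hb, hba, rfl⟩
  exact hW.le_of_not_le (hF b hb) he.1 (hcon b hb hba)

/-- Distances are not symmetric, and the two halves of convergence give different indices b and b'.
The way from p(b) back to x passes through p(b'), which costs a further e + e by the Cauchy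
condition. -/
theorem exists_close (h : S.IsGDS V) (hV : IsTransitiveModelZFC V) {A p x : ZFSet.{u}}
    (hp : S.IsCauchySeq V A p) (hx : x ∈ S.pts) (hconv : S.ConvergesTo A p x) {e : ZFSet.{u}}
    (he : e ∈ S.pos) :
    ∃ b ∈ A, S.Le b e ∧ S.Le (S.d x (setApp p b)) e ∧
      S.Le (S.d (setApp p b) x) (S.plus (S.plus e e) e) := by
  have hW := h.isDistanceMonoid
  have hM := h.isMetricSpace
  have hxV := hV.mem_of_mem hx hM.pts_mem
  have hpA : ∀ b ∈ A, setApp p b ∈ S.pts := fun b hb => hp.isFunc.setApp_mem hb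
  have hA : A ∈ V := by
    have : A = ZFSet.sep (fun a => ∃ y ∈ S.pts, ZFSet.pair a y ∈ p) S.carrier := by
      ext a
      rw [ZFSet.mem_sep]
      constructor
      · exact fun ha => ⟨(mem_pos.1 (hp.subset ha)).1, _, hpA a ha, hp.isFunc.setApp_spec ha⟩
      · rintro ⟨-, y, -, hay⟩
        exact (ZFSet.pair_mem_prod.1 (hp.isFunc.1 hay)).1
    rw [this]
    exact hV.sep_mem hW.carrier_mem (.exMem hV (.const hM.pts_mem)
      (.mem (.pair hV (.var _) (.var _)) (.const hp.mem)))
  obtain ⟨b, hb, hbe, hxb⟩ := h.exists_le_of_isJoin_zero hV hA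
    (fun b hb => hM.d_mem hx (hpA b hb))
    (fun ht => hM.defF_d hV (.const hxV) (.app hV hp.mem hp.isFunc.isFunctional ht))
    hconv.1 he he
  obtain ⟨b', hb', hbe', hxb'⟩ := h.exists_le_of_isJoin_zero hV hA
    (fun b hb => hM.d_mem (hpA b hb) hx)
    (fun ht => hM.defF_d hV (.app hV hp.mem hp.isFunc.isFunctional ht) (.const hxV))
    hconv.2 he he
  refine ⟨b, hb, hbe, hxb, hW.trans (hM.triangle _ (hpA b hb) _ (hpA b' hb') _ hx) ?_⟩
  exact hW.add_le_add' (hW.trans (hp.cauchy b hb b' hb') (hW.add_le_add' hbe hbe')) hxb'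

/-- The limit of a Cauchy sequence of approximate fixed points is a fixed point. -/
theorem hasFixedPoint_of_isCauchySeq (h : S.IsGDS V) (hV : IsTransitiveModelZFC V)
    (hcont : S.toDMon.IsContinuousAtZero) {A p : ZFSet.{u}} (hp : S.IsCauchySeq V A p)
    (hf : ∀ b ∈ A, S.Le (S.d (setApp p b) (S.f (setApp p b))) (S.plus b b) ∧
      S.Le (S.d (S.f (setApp p b)) (setApp p b)) (S.plus b b)) : S.HasFixedPoint := by
  have hW := h.isDistanceMonoid
  have hM := h.isMetricSpace
  obtain ⟨x, hx, hconv⟩ := h.cauchyComplete A p hp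
  have hfx := h.f_mem hx
  refine ⟨x, hx, ?_⟩
  suffices hs : ∀ c ∈ S.pos, S.Le (S.d x (S.f x)) c ∧ S.Le (S.d (S.f x) x) c by
    have key : ∀ t ∈ S.carrier, (∀ c ∈ S.pos, S.Le t c) → t = S.zero := by
      intro t ht hle
      by_contra hne
      obtain ⟨e, he, hne'⟩ := hW.exists_half hcont (mem_pos.2 ⟨ht, hne⟩)
      have he' := (mem_pos.1 he).1
      exact hne' (hW.trans (hle e he) (hW.le_add_right he' he'))
    exact ((hM.eq_iff _ hx _ hfx).1 ⟨key _ (hM.d_mem hx hfx) fun c hc => (hs c hc).1,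
      key _ (hM.d_mem hfx hx) fun c hc => (hs c hc).2⟩).symm
  intro c hc
  -- The path between x and f x through p(b) and f(p(b)) has, in either direction, two steps of at
  -- most c₂ and a last one of at most c₁; the total is at most c₁ + c₁.
  obtain ⟨c₁, hc₁, hc₁'⟩ := hW.exists_add_self_le hcont hc
  obtain ⟨c₂, hc₂, hc₂'⟩ := hW.exists_add_self_le hcont hc₁
  obtain ⟨e, he, he'⟩ := hW.exists_add_self_le hcont hc₂
  have hmc₁ := (mem_pos.1 hc₁).1
  have hmc₂ := (mem_pos.1 hc₂).1
  have hme := (mem_pos.1 he).1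
  obtain ⟨b, hb, hbe, hxb, hbx⟩ := h.exists_close hV hp hx hconv he
  have hpb := hp.isFunc.setApp_mem hb
  have hfpb := h.f_mem hpb
  have hec₂ : S.Le e c₂ := hW.trans (hW.le_add_right hme hme) he'
  have hc₂c₁ : S.Le c₂ c₁ := hW.trans (hW.le_add_right hmc₂ hmc₂) hc₂'
  have hbx' : S.Le (S.d (setApp p b) x) c₁ :=
    hW.trans hbx (hW.trans (hW.add_le_add' he' hec₂) hc₂')
  have hbb : S.Le (S.plus b b) c₂ := hW.trans (hW.add_le_add' hbe hbe) he'
  have hxb' : S.Le (S.d x (setApp p b)) c₂ := hW.trans hxb hec₂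
  constructor
  · refine hW.trans (hM.triangle _ hx _ hfpb _ hfx) (hW.trans (hW.add_le_add' ?_
      (hW.trans (h.nonexpanding _ hpb _ hx) hbx')) hc₁')
    exact hW.trans (hM.triangle _ hx _ hpb _ hfpb)
      (hW.trans (hW.add_le_add' hxb' (hW.trans (hf b hb).1 hbb)) hc₂')
  · refine hW.trans (hM.triangle _ hfx _ hpb _ hx) (hW.trans (hW.add_le_add' ?_ hbx') hc₁')
    exact hW.trans (hM.triangle _ hfx _ hfpb _ hpb) (hW.trans (hW.add_le_add'
      (hW.trans (h.nonexpanding _ hx _ hpb) hxb') (hW.trans (hf b hb).2 hbb)) hc₂')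

end IsGDS

end GDS

/-! ### Approximate fixed points of a ground-model system -/

namespace GDS

open DMon

variable {V : Set ZFSet.{u}} {S : GDS.{u}} {s : ZFSet.{u}}

/-- The pairs `(a, y)` of a value `a` of the initial sequence `s` and a point `y` that is moved by
at most `a + a`. -/
noncomputable def approxNodes (S : GDS.{u}) (s : ZFSet.{u}) : ZFSet.{u} :=
  ZFSet.sep (fun q => ∃ a ∈ S.carrier, ∃ y ∈ S.pts, q = ZFSet.pair a y ∧
    (∃ i ∈ ZFSet.omega, a = setApp s i) ∧ S.Le (S.d y (S.f y)) (S.plus a a) ∧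
    S.Le (S.d (S.f y) y) (S.plus a a)) (S.carrier.prod S.pts)

/-- The relation of the formal ball `(a', y')` being strictly inside of the formal ball `(a, y)`. -/
noncomputable def approxRel (S : GDS.{u}) (s : ZFSet.{u}) : ZFSet.{u} :=
  ZFSet.sep (fun q => ∃ a' ∈ S.carrier, ∃ y' ∈ S.pts, ∃ a ∈ S.carrier, ∃ y ∈ S.pts,
    q = ZFSet.pair (ZFSet.pair a' y') (ZFSet.pair a y) ∧ a' ≠ a ∧
    S.Le (S.plus (S.d y y') a') a ∧ S.Le (S.plus (S.d y' y) a') a)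
    ((S.approxNodes s).prod (S.approxNodes s))

theorem pair_mem_approxNodes {a y : ZFSet.{u}} : ZFSet.pair a y ∈ S.approxNodes s ↔
    a ∈ S.carrier ∧ y ∈ S.pts ∧ (∃ i ∈ ZFSet.omega, a = setApp s i) ∧
    S.Le (S.d y (S.f y)) (S.plus a a) ∧ S.Le (S.d (S.f y) y) (S.plus a a) := by
  rw [approxNodes, ZFSet.mem_sep, ZFSet.pair_mem_prod]
  constructor
  · rintro ⟨-, a', ha, y', hy, he, h⟩
    obtain ⟨rfl, rfl⟩ := ZFSet.pair_inj.1 he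
    exact ⟨ha, hy, h⟩
  · rintro ⟨ha, hy, h⟩
    exact ⟨⟨ha, hy⟩, a, ha, y, hy, rfl, h⟩

theorem exists_eq_of_mem_approxNodes {q : ZFSet.{u}} (hq : q ∈ S.approxNodes s) :
    ∃ n y, q = ZFSet.pair (setApp s (natSet n)) y := by
  obtain ⟨-, a, -, y, -, rfl, ⟨i, hi, rfl⟩, -⟩ := ZFSet.mem_sep.1 hq
  obtain ⟨n, rfl⟩ := mem_omega_iff.1 hi
  exact ⟨n, y, rfl⟩

theorem pair_mem_approxRel {a y a' y' : ZFSet.{u}} :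
    ZFSet.pair (ZFSet.pair a' y') (ZFSet.pair a y) ∈ S.approxRel s ↔
    ZFSet.pair a' y' ∈ S.approxNodes s ∧ ZFSet.pair a y ∈ S.approxNodes s ∧ a' ≠ a ∧
    S.Le (S.plus (S.d y y') a') a ∧ S.Le (S.plus (S.d y' y) a') a := by
  rw [approxRel, ZFSet.mem_sep, ZFSet.pair_mem_prod, and_assoc]
  refine and_congr_right fun h' => and_congr_right fun h => ?_
  constructor
  · rintro ⟨b', -, z', -, b, -, z, -, he, h⟩
    rw [ZFSet.pair_inj, ZFSet.pair_inj, ZFSet.pair_inj] at he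
    obtain ⟨⟨rfl, rfl⟩, rfl, rfl⟩ := he
    exact h
  · intro hr
    rw [pair_mem_approxNodes] at h h'
    exact ⟨a', h'.1, y', h'.2.1, a, h.1, y, h.2.1, rfl, hr⟩

theorem approxRel_subset : S.approxRel s ⊆ (S.approxNodes s).prod (S.approxNodes s) :=
  fun _ hq => (ZFSet.mem_sep.1 hq).1

/-- As the domain of s, the set ω can be separated from ⋃⋃s. -/
theorem omega_mem_of_isInitialSeq {W : DMon.{u}} (hV : IsTransitiveModelZFC V)
    (hW : W.IsDistanceMonoid V) (hs : W.IsInitialSeq V ZFSet.omega s) : ZFSet.omega ∈ V := by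
  have hu := hV.sUnion_mem (hV.sUnion_mem hs.mem)
  have : ZFSet.omega = ZFSet.sep (fun i => ∃ a ∈ W.carrier, ZFSet.pair i a ∈ s)
      (ZFSet.sUnion (ZFSet.sUnion s)) := by
    ext i
    rw [ZFSet.mem_sep]
    constructor
    · intro hi
      have hia := hs.isFunc.setApp_spec hi
      refine ⟨?_, _, (mem_pos.1 (hs.isFunc.setApp_mem hi)).1, hia⟩
      exact ZFSet.mem_sUnion_of_mem (z := {i}) (by simp)
        (ZFSet.mem_sUnion_of_mem (z := ZFSet.pair i (setApp s i)) (by simp [ZFSet.pair]) hia)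
    · rintro ⟨-, a, -, hia⟩
      exact (ZFSet.pair_mem_prod.1 (hs.isFunc.1 hia)).1
  rw [this]
  exact hV.sep_mem hu (.exMem hV (.const hW.carrier_mem)
    (.mem (.pair hV (.var _) (.var _)) (.const hs.mem)))

theorem IsGDS.approxNodes_mem (h : S.IsGDS V) (hV : IsTransitiveModelZFC V)
    (hs : S.toDMon.IsInitialSeq V ZFSet.omega s) : S.approxNodes s ∈ V := by
  have hW := h.isDistanceMonoid
  have hM := h.isMetricSpace
  have hω := omega_mem_of_isInitialSeq hV hW hs
  refine hV.sep_mem (hV.prod_mem hW.carrier_mem hM.pts_mem) (.exMem hV (.const hW.carrier_mem)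
    (.exMem hV (.const hM.pts_mem) (.and (.eq (.var _) (.pair hV (.var _) (.var _)))
    (.and (.exMem hV (.const hω) (.eq (.var _)
      (.app hV hs.mem hs.isFunc.isFunctional (.var _)))) (.and ?_ ?_)))))
  · exact hW.dfn_le hV (hM.defF_d hV (.var _) (h.defF_f hV (.var _)))
      (hW.defF_plus hV (.var _) (.var _))
  · exact hW.dfn_le hV (hM.defF_d hV (h.defF_f hV (.var _)) (.var _))
      (hW.defF_plus hV (.var _) (.var _))

theorem IsGDS.approxRel_mem (h : S.IsGDS V) (hV : IsTransitiveModelZFC V)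
    (hs : S.toDMon.IsInitialSeq V ZFSet.omega s) : S.approxRel s ∈ V := by
  have hW := h.isDistanceMonoid
  have hM := h.isMetricSpace
  have hX := h.approxNodes_mem hV hs
  refine hV.sep_mem (hV.prod_mem hX hX) (.exMem hV (.const hW.carrier_mem)
    (.exMem hV (.const hM.pts_mem) (.exMem hV (.const hW.carrier_mem)
    (.exMem hV (.const hM.pts_mem) (.and (.eq (.var _) (.pair hV (.pair hV (.var _) (.var _))
      (.pair hV (.var _) (.var _)))) (.and (.not (.eq (.var _) (.var _))) (.and ?_ ?_)))))))
  · exact hW.dfn_le hV (hW.defF_plus hV (hM.defF_d hV (.var _) (.var _)) (.var _)) (.var _)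
  · exact hW.dfn_le hV (hW.defF_plus hV (hM.defF_d hV (.var _) (.var _)) (.var _)) (.var _)

/-- This is the triangle inequality for formal balls, and the reason for bounding d + a' by a; the
absoluteness of the well-founded part relies on it. The radii stay distinct because they decrease
along the relation. -/
theorem IsGDS.approxRel_trans (h : S.IsGDS V) (p q r : ZFSet.{u})
    (hpq : ZFSet.pair p q ∈ S.approxRel s) (hqr : ZFSet.pair q r ∈ S.approxRel s) :
    ZFSet.pair p r ∈ S.approxRel s := by
  have hW := h.isDistanceMonoid
  have hM := h.isMetricSpace
  obtain ⟨hp, hq⟩ := ZFSet.pair_mem_prod.1 (approxRel_subset hpq)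
  obtain ⟨-, hr⟩ := ZFSet.pair_mem_prod.1 (approxRel_subset hqr)
  obtain ⟨l, x, rfl⟩ := exists_eq_of_mem_approxNodes hp
  obtain ⟨m, y, rfl⟩ := exists_eq_of_mem_approxNodes hq
  obtain ⟨n, z, rfl⟩ := exists_eq_of_mem_approxNodes hr
  generalize setApp s (natSet l) = a at *
  generalize setApp s (natSet m) = b at *
  generalize setApp s (natSet n) = c at *
  obtain ⟨-, -, hab, h1, h2⟩ := pair_mem_approxRel.1 hpq
  obtain ⟨-, -, hbc, h3, h4⟩ := pair_mem_approxRel.1 hqr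
  obtain ⟨ha, hx, -⟩ := pair_mem_approxNodes.1 hp
  obtain ⟨hb, hy, -⟩ := pair_mem_approxNodes.1 hq
  obtain ⟨hc, hz, -⟩ := pair_mem_approxNodes.1 hr
  have hab' : S.Le a b := hW.trans (hW.le_add_left ha (hM.d_mem hx hy)) h2
  have hbc' : S.Le b c := hW.trans (hW.le_add_left hb (hM.d_mem hy hz)) h4
  refine pair_mem_approxRel.2 ⟨hp, hr, ?_, ?_, ?_⟩
  · rintro rfl
    exact hab (hW.le_antisymm _ ha _ hb hab' hbc')
  · refine hW.trans (hW.add_le_add' (hM.triangle z hz y hy x hx) (hW.le_refl a ha)) ?_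
    rw [hW.add_assoc _ (hM.d_mem hz hy) _ (hM.d_mem hy hx) _ ha]
    exact hW.trans (hW.add_le_add' (hW.le_refl _ (hM.d_mem hz hy)) h1) h3
  · refine hW.trans (hW.add_le_add' (hM.triangle x hx y hy z hz) (hW.le_refl a ha)) ?_
    rw [hW.add_comm _ (hM.d_mem hx hy) _ (hM.d_mem hy hz),
      hW.add_assoc _ (hM.d_mem hy hz) _ (hM.d_mem hx hy) _ ha]
    exact hW.trans (hW.add_le_add' (hW.le_refl _ (hM.d_mem hy hz)) h2) h4

/-- If the relation between approximate fixed points is ill-founded, even if this is witnessed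
outside of the model only, then there is a fixed point. -/
theorem IsGDS.hasFixedPoint_of_not_acc (h : S.IsGDS V) (hV : IsTransitiveModelZFC V)
    (hcont : S.toDMon.IsContinuousAtZero) (hs : S.toDMon.IsInitialSeq V ZFSet.omega s)
    {q₀ : ZFSet.{u}} (hq₀ : q₀ ∈ S.approxNodes s)
    (hacc : ¬ Acc (fun v w => ZFSet.pair v w ∈ S.approxRel s) q₀) : S.HasFixedPoint := by
  have hW := h.isDistanceMonoid
  have hM := h.isMetricSpace
  have hX := h.approxNodes_mem hV hs
  have hR := h.approxRel_mem hV hs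
  have hP := sep_not_acc_mem hV hR hX approxRel_subset h.approxRel_trans
  have hspos : ∀ n, setApp s (natSet n) ∈ S.pos := fun n =>
    hs.isFunc.setApp_mem (natSet_mem_omega n)
  have hanti : ∀ {m n}, m ≤ n → S.Le (setApp s (natSet n)) (setApp s (natSet m)) := by
    intro m n hmn
    rcases hmn.eq_or_lt with rfl | hlt
    · exact hW.le_refl _ (mem_pos.1 (hspos m)).1
    · exact hs.antitone _ (natSet_mem_omega m) _ (natSet_mem_omega n) (natSet_mem_natSet hlt)
  have hex : ∀ q ∈ S.approxNodes s, ∃ n y, q = ZFSet.pair (setApp s (natSet n)) y :=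
    fun q hq => exists_eq_of_mem_approxNodes hq
  choose! idx pt hidx using hex
  -- Going strictly inside lowers the radius, and s is antitone, so the index rises.
  have hlt : ∀ {q r}, ZFSet.pair r q ∈ S.approxRel s → idx q < idx r := by
    intro q r hrq
    obtain ⟨hr, hq⟩ := ZFSet.pair_mem_prod.1 (approxRel_subset hrq)
    rw [hidx q hq, hidx r hr] at hrq
    obtain ⟨hr', hq', hne, -, hle⟩ := pair_mem_approxRel.1 hrq
    by_contra! hcon
    have hr'' := pair_mem_approxNodes.1 hr'
    have hq'' := pair_mem_approxNodes.1 hq'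
    exact hne (hW.le_antisymm _ hr''.1 _ hq''.1
      (hW.trans (hW.le_add_left hr''.1 (hM.d_mem hr''.2.1 hq''.2.1)) hle) (hanti hcon))
  obtain ⟨O, hO, b, hbP, hbR, hbO⟩ := exists_branch hV hR hP ⟨q₀, ZFSet.mem_sep.2 ⟨hq₀, hacc⟩⟩
    (by
      intro q hq
      obtain ⟨hq, hqa⟩ := ZFSet.mem_sep.1 hq
      by_contra! hcon
      refine hqa ⟨q, fun r hr => ?_⟩
      by_contra hra
      exact hcon r (ZFSet.mem_sep.2 ⟨(ZFSet.pair_mem_prod.1 (approxRel_subset hr)).1, hra⟩) hr)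
    idx (fun _ _ _ _ hr => hlt hr)
  have hbX : ∀ k, b k ∈ S.approxNodes s := fun k => (ZFSet.mem_sep.1 (hbP k)).1
  let a : ℕ → ZFSet.{u} := fun k => setApp s (natSet (idx (b k)))
  let y : ℕ → ZFSet.{u} := fun k => pt (b k)
  have hb : ∀ k, b k = ZFSet.pair (a k) (y k) := fun k => hidx _ (hbX k)
  have hnode : ∀ k, a k ∈ S.carrier ∧ y k ∈ S.pts ∧ (∃ i ∈ ZFSet.omega, a k = setApp s i) ∧
      S.Le (S.d (y k) (S.f (y k))) (S.plus (a k) (a k)) ∧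
      S.Le (S.d (S.f (y k)) (y k)) (S.plus (a k) (a k)) := fun k =>
    pair_mem_approxNodes.1 (hb k ▸ hbX k)
  have hrel : ∀ {k l}, k < l → a l ≠ a k ∧ S.Le (S.plus (S.d (y k) (y l)) (a l)) (a k) ∧
      S.Le (S.plus (S.d (y l) (y k)) (a l)) (a k) := by
    intro k l hkl
    have : ZFSet.pair (b l) (b k) ∈ S.approxRel s := by
      induction l, hkl using Nat.le_induction with
      | base => exact hbR k
      | succ l _ ih => exact h.approxRel_trans _ _ _ (hbR l) ih
    rw [hb k, hb l] at this
    exact (pair_mem_approxRel.1 this).2.2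
  have hinj : ∀ {k l}, a k = a l → k = l := by
    intro k l hkl
    rcases lt_trichotomy k l with hlt | heq | hlt
    exacts [absurd hkl.symm (hrel hlt).1, heq, absurd hkl (hrel hlt).1]
  -- Strictly increasing indices are at least k, so the radii along the branch are coinitial.
  have hasmall : ∀ k, S.Le (a k) (setApp s (natSet k)) := fun k =>
    hanti (StrictMono.le_apply (f := fun k => idx (b k)) (strictMono_nat_of_lt_succ fun k =>
      hlt (hbR k)))
  let A := ZFSet.sep (fun c => ∃ k, c = a k) S.carrier
  have hmA : ∀ {c}, c ∈ A ↔ ∃ k, c = a k := fun {c} => by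
    rw [ZFSet.mem_sep, and_iff_right_iff_imp]
    rintro ⟨k, rfl⟩
    exact (hnode k).1
  -- The nodes are pairs (a k, y k) with distinct a k, so the branch O is already the graph of the
  -- Cauchy sequence.
  have hfun : ZFSet.IsFunc A S.pts O := by
    constructor
    · intro q hq
      obtain ⟨k, rfl⟩ := (hbO q).1 hq
      rw [hb k]
      exact ZFSet.pair_mem_prod.2 ⟨hmA.2 ⟨k, rfl⟩, (hnode k).2.1⟩
    · intro c hc
      obtain ⟨k, rfl⟩ := hmA.1 hc
      refine ⟨y k, (hbO _).2 ⟨k, (hb k).symm⟩, fun z hz => ?_⟩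
      obtain ⟨l, hl⟩ := (hbO _).1 hz
      rw [hb l, ZFSet.pair_inj] at hl
      rw [hl.2, hinj hl.1]
  have happ : ∀ k, setApp O (a k) = y k := fun k =>
    hfun.isFunctional.setApp_eq ((hbO _).2 ⟨k, (hb k).symm⟩)
  refine h.hasFixedPoint_of_isCauchySeq hV hcont (A := A) (p := O) ⟨hO, ?_, hfun, ⟨?_, ?_, ?_⟩, ?_⟩ ?_
  · intro c hc
    obtain ⟨k, rfl⟩ := hmA.1 hc
    exact hspos _
  · exact hW.zero_mem_carrier
  · rintro _ ⟨c, hc, e, he, rfl⟩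
    exact hW.zero_le _ (hW.plus_mem (ZFSet.mem_sep.1 hc).1 (ZFSet.mem_sep.1 he).1)
  · intro c hc hle
    by_contra hne
    obtain ⟨e, he, hce⟩ := hW.exists_half hcont (mem_pos.2 ⟨hc, fun h0 =>
      hne (h0 ▸ hW.le_refl _ hc)⟩)
    obtain ⟨i, hi, hie⟩ := hs.coinitial e he
    obtain ⟨k, rfl⟩ := mem_omega_iff.1 hi
    have hae := hW.trans (hasmall k) hie
    exact hce (hW.trans (hle _ ⟨a k, hmA.2 ⟨k, rfl⟩, a k, hmA.2 ⟨k, rfl⟩, rfl⟩)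
      (hW.add_le_add' hae hae))
  · intro c hc e he
    obtain ⟨k, rfl⟩ := hmA.1 hc
    obtain ⟨l, rfl⟩ := hmA.1 he
    rw [happ, happ]
    have hak := (hnode k).1
    have hal := (hnode l).1
    have hyk := (hnode k).2.1
    have hyl := (hnode l).2.1
    rcases lt_trichotomy k l with hkl | rfl | hkl
    · exact hW.trans (hW.le_add_right (hM.d_mem hyk hyl) hal)
        (hW.trans (hrel hkl).2.1 (hW.le_add_right hak hal))
    · rw [hM.d_self hyk]
      exact hW.zero_le _ (hW.plus_mem hak hak)
    · exact hW.trans (hW.le_add_right (hM.d_mem hyk hyl) hak)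
        (hW.trans (hrel hkl).2.2 (hW.le_add_left hal hak))
  · intro c hc
    obtain ⟨k, rfl⟩ := hmA.1 hc
    rw [happ]
    exact (hnode k).2.2.2

/-! ### Fixed points of an extension that are approximated in the ground model -/

variable {V₀ V₁ : Set ZFSet.{u}} {S₀ S₁ : GDS.{u}}

/-- A ball around a ground-model point that contains x with slack c > 0 always has such a ball
strictly inside it, so none of these nodes is accessible. If y is within a of x both ways, then y is
moved by at most a + a, since x is fixed and f is non-expanding. Comparisons are made in W₁ and
reflected to W₀ by `hle`. -/
theorem hasFixedPoint_of_approximated (hV₀ : IsTransitiveModelZFC V₀) (hS₀ : S₀.IsGDS V₀)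
    (hcont : S₀.toDMon.IsContinuousAtZero) (hs : S₀.toDMon.IsInitialSeq V₀ ZFSet.omega s)
    (hS₁ : S₁.IsGDS V₁) (hsub : S₀.IsSubstructure S₁)
    (hle : ∀ a ∈ S₀.carrier, ∀ b ∈ S₀.carrier, S₁.Le a b → S₀.Le a b)
    {x : ZFSet.{u}} (hx : x ∈ S₁.pts) (hfx : S₁.f x = x)
    (happrox : ∀ c ∈ S₀.pos, ∃ y ∈ S₀.pts, S₁.Le (S₁.d x y) c ∧ S₁.Le (S₁.d y x) c) :
    S₀.HasFixedPoint := by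
  have hW := hS₀.isDistanceMonoid
  have hM := hS₀.isMetricSpace
  have hW₁ := hS₁.isDistanceMonoid
  have hM₁ := hS₁.isMetricSpace
  have hp : ∀ {c}, c ∈ S₀.pos → c ∈ S₀.carrier := fun hc => (mem_pos.1 hc).1
  have hp₁ : ∀ {c}, c ∈ S₀.carrier → c ∈ S₁.carrier := fun hc => hsub.carrier_subset hc
  have hpt₁ : ∀ {y}, y ∈ S₀.pts → y ∈ S₁.pts := fun hy => hsub.pts_subset hy
  have hself : ∀ {c}, c ∈ S₀.carrier → S₁.Le c c := fun hc => hW₁.le_refl _ (hp₁ hc)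
  -- A point close to `x` gives a node of the relation.
  have node : ∀ n, ∃ y c, c ∈ S₀.pos ∧ ZFSet.pair (setApp s (natSet n)) y ∈ S₀.approxNodes s ∧
      S₁.Le (S₁.plus (S₁.d y x) c) (setApp s (natSet n)) ∧
      S₁.Le (S₁.plus (S₁.d x y) c) (setApp s (natSet n)) := by
    intro n
    have hi := natSet_mem_omega n
    have ha := hs.isFunc.setApp_mem hi
    generalize hadef : setApp s (natSet n) = a at *
    obtain ⟨c, hc, hca⟩ := hW.exists_add_self_le hcont ha
    obtain ⟨y, hy, hxy, hyx⟩ := happrox c hc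
    have hca₁ : S₁.Le (S₁.plus c c) a := by
      rw [hsub.plus_eq c (hp hc) c (hp hc)]
      exact hsub.le_of_le _ (hW.plus_mem (hp hc) (hp hc)) _ (hp ha) hca
    have h1 : S₁.Le (S₁.plus (S₁.d y x) c) a :=
      hW₁.trans (hW₁.add_le_add' hyx (hself (hp hc))) hca₁
    have h2 : S₁.Le (S₁.plus (S₁.d x y) c) a :=
      hW₁.trans (hW₁.add_le_add' hxy (hself (hp hc))) hca₁
    have hyx' := hW₁.trans (hW₁.le_add_right (hM₁.d_mem (hpt₁ hy) hx) (hp₁ (hp hc))) h1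
    have hxy' := hW₁.trans (hW₁.le_add_right (hM₁.d_mem hx (hpt₁ hy)) (hp₁ (hp hc))) h2
    have hfy := hS₀.f_mem hy
    have hn1 := hS₁.nonexpanding x hx y (hpt₁ hy)
    have hn2 := hS₁.nonexpanding y (hpt₁ hy) x hx
    rw [hfx, hsub.f_eq y hy] at hn1 hn2
    refine ⟨y, c, hc, pair_mem_approxNodes.2 ⟨hp ha, hy, ⟨_, hi, hadef.symm⟩, ?_, ?_⟩, h1, h2⟩
    · refine hle _ (hM.d_mem hy hfy) _ (hW.plus_mem (hp ha) (hp ha)) ?_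
      rw [← hsub.d_eq _ hy _ hfy, ← hsub.plus_eq _ (hp ha) _ (hp ha)]
      exact hW₁.trans (hM₁.triangle _ (hpt₁ hy) _ hx _ (hpt₁ hfy))
        (hW₁.add_le_add' hyx' (hW₁.trans hn1 hxy'))
    · refine hle _ (hM.d_mem hfy hy) _ (hW.plus_mem (hp ha) (hp ha)) ?_
      rw [← hsub.d_eq _ hfy _ hy, ← hsub.plus_eq _ (hp ha) _ (hp ha)]
      exact hW₁.trans (hM₁.triangle _ (hpt₁ hfy) _ hx _ (hpt₁ hy))
        (hW₁.add_le_add' (hW₁.trans hn2 hyx') hxy')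
  have key : ∀ q, Acc (fun v w => ZFSet.pair v w ∈ S₀.approxRel s) q →
      ∀ a y c, q = ZFSet.pair a y → q ∈ S₀.approxNodes s → c ∈ S₀.pos →
      S₁.Le (S₁.plus (S₁.d y x) c) a → S₁.Le (S₁.plus (S₁.d x y) c) a → False := by
    intro q hq
    induction hq with
    | intro q _ ih =>
      rintro a y c rfl hay hc h1 h2
      obtain ⟨ha, hy, -⟩ := pair_mem_approxNodes.1 hay
      -- With a' = s(n) ≤ e and e + e < c, d(y, y') + a' ≤ d(y, x) + a' + a' ≤ d(y, x) + c ≤ a, and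
      -- likewise for d(y', y). Also a' ≠ a, as a' + a' < c ≤ a.
      obtain ⟨e, he, hce⟩ := hW.exists_half hcont hc
      obtain ⟨i, hi, hie⟩ := hs.coinitial e he
      obtain ⟨n, rfl⟩ := mem_omega_iff.1 hi
      obtain ⟨y', c', hc', hnode, h1', h2'⟩ := node n
      have ha' := hp (hs.isFunc.setApp_mem (natSet_mem_omega n))
      have hy' := (pair_mem_approxNodes.1 hnode).2.1
      refine ih _ ?_ _ _ c' rfl hnode hc' h1' h2'
      generalize setApp s (natSet n) = a' at *
      have hee := hW.plus_mem (hp he) (hp he)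
      have haa : S₀.Le (S₀.plus a' a') (S₀.plus e e) := hW.add_le_add' hie hie
      have haac : S₁.Le (S₁.plus a' a') c := by
        rw [hsub.plus_eq _ ha' _ ha']
        exact hsub.le_of_le _ (hW.plus_mem ha' ha') _ (hp hc)
          (hW.trans haa (hW.le_of_not_le (hp hc) hee hce))
      have hdyx := hM₁.d_mem (hpt₁ hy) hx
      have hdxy := hM₁.d_mem hx (hpt₁ hy)
      have hyx' := hW₁.trans (hW₁.le_add_right (hM₁.d_mem (hpt₁ hy') hx) (hp₁ (hp hc'))) h1'
      have hxy' := hW₁.trans (hW₁.le_add_right (hM₁.d_mem hx (hpt₁ hy')) (hp₁ (hp hc'))) h2'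
      have hxy'' := hM₁.d_mem hx (hpt₁ hy')
      have hyx'' := hM₁.d_mem (hpt₁ hy') hx
      have hca : S₀.Le c a := hle _ (hp hc) _ ha
        (hW₁.trans (hW₁.le_add_left (hp₁ (hp hc)) hdyx) h1)
      refine pair_mem_approxRel.2 ⟨hnode, hay, ?_, ?_, ?_⟩
      · rintro rfl
        exact hce (hW.trans hca (hW.trans (hW.le_add_right ha' ha') haa))
      · refine hle _ (hW.plus_mem (hM.d_mem hy hy') ha') _ ha ?_
        rw [← hsub.plus_eq _ (hM.d_mem hy hy') _ ha', ← hsub.d_eq _ hy _ hy']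
        refine hW₁.trans (hW₁.add_le_add' (hM₁.triangle _ (hpt₁ hy) _ hx _ (hpt₁ hy'))
          (hself ha')) ?_
        rw [hW₁.add_assoc _ hdyx _ hxy'' _ (hp₁ ha')]
        exact hW₁.trans (hW₁.add_le_add' (hW₁.le_refl _ hdyx)
          (hW₁.trans (hW₁.add_le_add' hxy' (hself ha')) haac)) h1
      · refine hle _ (hW.plus_mem (hM.d_mem hy' hy) ha') _ ha ?_
        rw [← hsub.plus_eq _ (hM.d_mem hy' hy) _ ha', ← hsub.d_eq _ hy' _ hy]
        refine hW₁.trans (hW₁.add_le_add' (hM₁.triangle _ (hpt₁ hy') _ hx _ (hpt₁ hy))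
          (hself ha')) ?_
        rw [hW₁.add_comm _ hyx'' _ hdxy, hW₁.add_assoc _ hdxy _ hyx'' _ (hp₁ ha')]
        exact hW₁.trans (hW₁.add_le_add' (hW₁.le_refl _ hdxy)
          (hW₁.trans (hW₁.add_le_add' hyx' (hself ha')) haac)) h2
  obtain ⟨y, c, hc, hnode, h1, h2⟩ := node 0
  exact hS₀.hasFixedPoint_of_not_acc hV₀ hcont hs hnode fun hacc =>
    key _ hacc _ y c rfl hnode hc h1 h2

theorem IsCompletionOf.hasFixedPoint (hV₀ : IsTransitiveModelZFC V₀)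
    (hV₁ : IsTransitiveModelZFC V₁) (hS₀ : S₀.IsGDS V₀)
    (hcont : S₀.toDMon.IsContinuousAtZero) (hs : S₀.toDMon.IsInitialSeq V₀ ZFSet.omega s)
    (h : S₀.IsCompletionOf V₁ S₁) (hfix : S₁.HasFixedPoint) : S₀.HasFixedPoint := by
  obtain ⟨x, hx, hfx⟩ := hfix
  have hsub := h.isSubstructure
  rcases h.dense x hx with hx₀ | ⟨A, p, hp, hpA, hconv⟩
  · exact ⟨x, hx₀, (hsub.f_eq x hx₀).symm.trans hfx⟩
  · have hW := hS₀.isDistanceMonoid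
    have hW₁ := h.isGDS.isDistanceMonoid
    refine hasFixedPoint_of_approximated hV₀ hS₀ hcont hs h.isGDS hsub
      (fun a ha b hb => (h.monoid.le_iff a ha b hb).1) hx hfx fun c hc => ?_
    -- Two halvings, because `exists_close` bounds one of the distances by e + e + e only.
    obtain ⟨c', hc', hcc'⟩ := hW.exists_add_self_le hcont hc
    obtain ⟨e, he, hec⟩ := hW.exists_add_self_le hcont hc'
    have hmc := (mem_pos.1 hc).1
    have hmc' := (mem_pos.1 hc').1
    have hme := (mem_pos.1 he).1
    have hec' : S₀.Le e c' := hW.trans (hW.le_add_right hme hme) hec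
    have hec'' : S₀.Le e c := hW.trans hec' (hW.trans (hW.le_add_right hmc' hmc') hcc')
    have he₁ : e ∈ S₁.pos :=
      mem_pos.2 ⟨hsub.carrier_subset hme, hsub.zero_eq ▸ (mem_pos.1 he).2⟩
    obtain ⟨b, hb, -, hxb, hbx⟩ := h.isGDS.exists_close hV₁ hp hx hconv he₁
    refine ⟨setApp p b, hpA b hb, hW₁.trans hxb (hsub.le_of_le _ hme _ hmc hec''),
      hW₁.trans hbx ?_⟩
    have hee := hW.plus_mem hme hme
    rw [hsub.plus_eq _ hme _ hme, hsub.plus_eq _ hee _ hme]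
    exact hsub.le_of_le _ (hW.plus_mem hee hme) _ hmc
      (hW.trans (hW.add_le_add' hec hec') hcc')

end GDS

/-! ### The distance monoid of all upper sets

The upper sets of a distance monoid `W`, ordered by reverse inclusion, form a complete distance
monoid that extends `W`; its positive elements have a least one, the set `W⁺`. -/

namespace DMon

variable {V V₀ : Set ZFSet.{u}} {W : DMon.{u}} {a b t x y z : ZFSet.{u}}

/-- `U` is an upper set of `W`. -/
def IsUpper (W : DMon.{u}) (U : ZFSet.{u}) : Prop :=
  U ⊆ W.carrier ∧ ∀ a ∈ U, ∀ b ∈ W.carrier, W.Le a b → b ∈ U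

/-- The elements of `W` (which stand for principal upper sets), and codes for the nonprincipal
upper sets that are in `V`. -/
noncomputable def upCarrier (V : Set ZFSet.{u}) (W : DMon.{u}) : ZFSet.{u} :=
  W.carrier ∪ ZFSet.sep (fun x => ∃ U ∈ V, x = ZFSet.pair W.carrier U ∧ W.IsUpper U ∧
    ¬ ∃ a ∈ W.carrier, ∀ t ∈ W.carrier, t ∈ U ↔ W.Le a t)
    (ZFSet.prod {W.carrier} W.carrier.powerset)

/-- `t` is in the upper set that is coded by `x`. -/
def InUp (V : Set ZFSet.{u}) (W : DMon.{u}) (t x : ZFSet.{u}) : Prop :=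
  W.Le x t ∨ ∃ U ∈ V, x = ZFSet.pair W.carrier U ∧ t ∈ U

/-- The sum of two upper sets is the upper set generated by the sums of their elements. -/
noncomputable def upAdd (V : Set ZFSet.{u}) (W : DMon.{u}) : ZFSet.{u} :=
  ZFSet.sep (fun q => ∃ x ∈ W.upCarrier V, ∃ y ∈ W.upCarrier V, ∃ z ∈ W.upCarrier V,
    q = ZFSet.pair (ZFSet.pair x y) z ∧ ∀ t ∈ W.carrier, W.InUp V t z ↔
      ∃ a ∈ W.carrier, ∃ b ∈ W.carrier, W.InUp V a x ∧ W.InUp V b y ∧ W.Le (W.plus a b) t)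
    (((W.upCarrier V).prod (W.upCarrier V)).prod (W.upCarrier V))

/-- The reverse inclusion of upper sets. -/
noncomputable def upLe (V : Set ZFSet.{u}) (W : DMon.{u}) : ZFSet.{u} :=
  ZFSet.sep (fun q => ∃ x ∈ W.upCarrier V, ∃ y ∈ W.upCarrier V, q = ZFSet.pair x y ∧
    ∀ t ∈ W.carrier, W.InUp V t y → W.InUp V t x) ((W.upCarrier V).prod (W.upCarrier V))

/-- The distance monoid of the upper sets of `W` that are in `V`. -/
noncomputable def upMonoid (V : Set ZFSet.{u}) (W : DMon.{u}) : DMon.{u} where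
  carrier := W.upCarrier V
  add := W.upAdd V
  zero := W.zero
  le := W.upLe V

theorem upAdd_subset :
    W.upAdd V ⊆ ((W.upCarrier V).prod (W.upCarrier V)).prod (W.upCarrier V) :=
  fun _ hq => (ZFSet.mem_sep.1 hq).1

theorem upLe_subset : W.upLe V ⊆ (W.upCarrier V).prod (W.upCarrier V) :=
  fun _ hq => (ZFSet.mem_sep.1 hq).1

theorem pair_mem_upAdd : ZFSet.pair (ZFSet.pair x y) z ∈ W.upAdd V ↔
    x ∈ W.upCarrier V ∧ y ∈ W.upCarrier V ∧ z ∈ W.upCarrier V ∧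
    ∀ t ∈ W.carrier, W.InUp V t z ↔
      ∃ a ∈ W.carrier, ∃ b ∈ W.carrier, W.InUp V a x ∧ W.InUp V b y ∧ W.Le (W.plus a b) t := by
  rw [upAdd, ZFSet.mem_sep, ZFSet.pair_mem_prod, ZFSet.pair_mem_prod]
  constructor
  · rintro ⟨⟨⟨hx, hy⟩, hz⟩, x', -, y', -, z', -, he, h⟩
    rw [ZFSet.pair_inj, ZFSet.pair_inj] at he
    obtain ⟨⟨rfl, rfl⟩, rfl⟩ := he
    exact ⟨hx, hy, hz, h⟩
  · rintro ⟨hx, hy, hz, h⟩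
    exact ⟨⟨⟨hx, hy⟩, hz⟩, x, hx, y, hy, z, hz, rfl, h⟩

/-- Otherwise W ∈ {W} ∈ (W, U) ∈ W is a membership cycle. So the codes of nonprincipal upper sets
never clash with elements of W. -/
theorem pair_carrier_notMem {U : ZFSet.{u}} : ZFSet.pair W.carrier U ∉ W.carrier := by
  intro h
  have h1 : W.carrier ∈ ({W.carrier} : ZFSet.{u}) := by simp
  have h2 : {W.carrier} ∈ ZFSet.pair W.carrier U := by simp [ZFSet.pair]
  exact ZFSet.inductionOn (p := fun x => ∀ y z, x ∈ y → y ∈ z → z ∉ x) W.carrier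
    (fun x ih y z hxy hyz hzx => ih z hzx x y hzx hxy hyz) _ _ h1 h2 h

namespace IsDistanceMonoid

theorem inUp_of_mem (ha : a ∈ W.carrier) : W.InUp V t a ↔ W.Le a t := by
  refine ⟨?_, .inl⟩
  rintro (h | ⟨U, -, rfl, -⟩)
  exacts [h, absurd ha pair_carrier_notMem]

theorem inUp_pair (h : W.IsDistanceMonoid V₀) {U : ZFSet.{u}} (hU : U ∈ V) :
    W.InUp V t (ZFSet.pair W.carrier U) ↔ t ∈ U := by
  refine ⟨?_, fun ht => .inr ⟨U, hU, rfl, ht⟩⟩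
  rintro (hle | ⟨U', -, he, ht⟩)
  · exact absurd (h.mem_of_le hle).1 pair_carrier_notMem
  · rwa [(ZFSet.pair_inj.1 he).2]

theorem mem_upCarrier : x ∈ W.upCarrier V ↔ x ∈ W.carrier ∨
    ∃ U ∈ V, x = ZFSet.pair W.carrier U ∧ W.IsUpper U ∧
      ¬ ∃ a ∈ W.carrier, ∀ t ∈ W.carrier, t ∈ U ↔ W.Le a t := by
  rw [upCarrier, ZFSet.mem_union, ZFSet.mem_sep, and_iff_right_of_imp]
  rintro ⟨U, -, rfl, hU, -⟩
  exact ZFSet.pair_mem_prod.2 ⟨by simp, ZFSet.mem_powerset.2 hU.1⟩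

theorem mem_upCarrier_of_mem (ha : a ∈ W.carrier) : a ∈ W.upCarrier V :=
  mem_upCarrier.2 (.inl ha)

theorem mem_of_inUp (h : W.IsDistanceMonoid V₀) (hx : x ∈ W.upCarrier V) (ht : W.InUp V t x) :
    t ∈ W.carrier := by
  rcases mem_upCarrier.1 hx with hx | ⟨U, hUV, rfl, hU, -⟩
  · exact (h.mem_of_le ((inUp_of_mem hx).1 ht)).2
  · exact hU.1 ((h.inUp_pair hUV).1 ht)

theorem inUp_mono (h : W.IsDistanceMonoid V₀) (hx : x ∈ W.upCarrier V) (ha : W.InUp V a x)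
    (hab : W.Le a b) : W.InUp V b x := by
  rcases mem_upCarrier.1 hx with hx | ⟨U, hUV, rfl, hU, -⟩
  · exact (inUp_of_mem hx).2 (h.trans ((inUp_of_mem hx).1 ha) hab)
  · exact (h.inUp_pair hUV).2 (hU.2 a ((h.inUp_pair hUV).1 ha) b (h.mem_of_le hab).2 hab)

/-- Pairs code nonprincipal upper sets only, so no upper set has two codes. -/
theorem ext_inUp (h : W.IsDistanceMonoid V₀) (hx : x ∈ W.upCarrier V) (hy : y ∈ W.upCarrier V)
    (hxy : ∀ t, W.InUp V t x ↔ W.InUp V t y) : x = y := by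
  rcases mem_upCarrier.1 hx with hx | ⟨U, hUV, rfl, hU, hnU⟩ <;>
    rcases mem_upCarrier.1 hy with hy | ⟨U', hUV', rfl, hU', hnU'⟩
  · simp only [inUp_of_mem hx, inUp_of_mem hy] at hxy
    exact h.le_antisymm x hx y hy ((hxy y).2 (h.le_refl y hy)) ((hxy x).1 (h.le_refl x hx))
  · simp only [inUp_of_mem hx, h.inUp_pair hUV'] at hxy
    exact absurd ⟨x, hx, fun t _ => (hxy t).symm⟩ hnU'
  · simp only [inUp_of_mem hy, h.inUp_pair hUV] at hxy
    exact absurd ⟨y, hy, fun t _ => hxy t⟩ hnU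
  · simp only [h.inUp_pair hUV, h.inUp_pair hUV'] at hxy
    rw [ZFSet.ext hxy]

theorem exists_inUp_iff (h : W.IsDistanceMonoid V₀) {U : ZFSet.{u}} (hUV : U ∈ V)
    (hU : W.IsUpper U) : ∃ x ∈ W.upCarrier V, ∀ t, W.InUp V t x ↔ t ∈ U := by
  by_cases hp : ∃ a ∈ W.carrier, ∀ t ∈ W.carrier, t ∈ U ↔ W.Le a t
  · obtain ⟨a, ha, haU⟩ := hp
    refine ⟨a, mem_upCarrier_of_mem ha, fun t => (inUp_of_mem ha).trans ?_⟩
    exact ⟨fun hat => (haU t (h.mem_of_le hat).2).2 hat, fun ht => (haU t (hU.1 ht)).1 ht⟩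
  · exact ⟨_, mem_upCarrier.2 (.inr ⟨U, hUV, rfl, hU, hp⟩), fun t => h.inUp_pair hUV⟩

theorem dfn_inUp (h : W.IsDistanceMonoid V₀) (hsub : V₀ ⊆ V) (hV : IsTransitiveModelZFC V) {n : ℕ}
    {s t : (Fin n → V) → ZFSet.{u}} (hs : DefF V s) (ht : DefF V t) :
    Dfn V (fun v => W.InUp V (s v) (t v)) :=
  .or (.mem (.pair hV ht hs) (.const (hsub h.le_mem))) (.exV (.and
    (.eq ht.tail (.pair hV (.const (hsub h.carrier_mem)) (.var _))) (.mem hs.tail (.var _))))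

theorem upCarrier_mem (h : W.IsDistanceMonoid V₀) (hsub : V₀ ⊆ V) (hV : IsTransitiveModelZFC V) :
    W.upCarrier V ∈ V := by
  have hc := hsub h.carrier_mem
  have hle : W.le ∈ V := hsub h.le_mem
  obtain ⟨B, hB, hmB⟩ := hV.exists_powerset hc
  -- The full power set in the definition may be outside V; as only U ∈ V are coded, the power set B
  -- computed in V serves as well.
  have : W.upCarrier V = W.carrier ∪ ZFSet.sep (fun x => ∃ U ∈ B, x = ZFSet.pair W.carrier U ∧
      (∀ a ∈ U, ∀ b ∈ W.carrier, W.Le a b → b ∈ U) ∧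
      ¬ ∃ a ∈ W.carrier, ∀ t ∈ W.carrier, t ∈ U ↔ W.Le a t)
      (ZFSet.prod {W.carrier, W.carrier} B) := by
    ext x
    rw [mem_upCarrier, ZFSet.mem_union, ZFSet.mem_sep]
    refine or_congr_right ⟨?_, ?_⟩
    · rintro ⟨U, hUV, rfl, hU, hn⟩
      have hUB := (hmB U).2 ⟨hUV, hU.1⟩
      exact ⟨ZFSet.pair_mem_prod.2 ⟨by simp, hUB⟩, U, hUB, rfl, hU.2, hn⟩
    · rintro ⟨-, U, hUB, rfl, hU, hn⟩
      obtain ⟨hUV, hUc⟩ := (hmB U).1 hUB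
      exact ⟨U, hUV, rfl, ⟨hUc, hU⟩, hn⟩
  rw [this]
  refine hV.union_mem hc (hV.sep_mem (hV.prod_mem (hV.upair_mem hc hc) hB) (.exMem hV (.const hB)
    (.and (.eq (.var _) (.pair hV (.const hc) (.var _))) (.and ?_ (.not ?_)))))
  · exact .allMem hV (.var _) (.allMem hV (.const hc) (.imp
      (.mem (.pair hV (.var _) (.var _)) (.const hle)) (.mem (.var _) (.var _))))
  · exact .exMem hV (.const hc) (.allMem hV (.const hc) (.iff (.mem (.var _) (.var _))
      (.mem (.pair hV (.var _) (.var _)) (.const hle))))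

theorem upMonoid_le_iff (h : W.IsDistanceMonoid V₀) (hx : x ∈ W.upCarrier V)
    (hy : y ∈ W.upCarrier V) :
    (W.upMonoid V).Le x y ↔ ∀ t, W.InUp V t y → W.InUp V t x := by
  rw [Le, upMonoid, upLe, ZFSet.mem_sep, ZFSet.pair_mem_prod, and_iff_right ⟨hx, hy⟩]
  constructor
  · rintro ⟨x', -, y', -, he, hxy⟩ t ht
    obtain ⟨rfl, rfl⟩ := ZFSet.pair_inj.1 he
    exact hxy t (h.mem_of_inUp hy ht) ht
  · exact fun hxy => ⟨x, hx, y, hy, rfl, fun t _ => hxy t⟩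

theorem exists_upMonoid_sum (h : W.IsDistanceMonoid V₀) (hsub : V₀ ⊆ V)
    (hV : IsTransitiveModelZFC V) (hx : x ∈ W.upCarrier V) (hy : y ∈ W.upCarrier V) :
    ∃ z ∈ W.upCarrier V, ∀ t, W.InUp V t z ↔
      ∃ a ∈ W.carrier, ∃ b ∈ W.carrier, W.InUp V a x ∧ W.InUp V b y ∧ W.Le (W.plus a b) t := by
  have hc : W.carrier ∈ V := hsub h.carrier_mem
  have hC := h.upCarrier_mem hsub hV
  have hxV := hV.mem_of_mem hx hC
  have hyV := hV.mem_of_mem hy hC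
  obtain ⟨z, hz, hzU⟩ := h.exists_inUp_iff (V := V) (U := ZFSet.sep (fun t => ∃ a ∈ W.carrier,
    ∃ b ∈ W.carrier, W.InUp V a x ∧ W.InUp V b y ∧ W.Le (W.plus a b) t) W.carrier)
    (hV.sep_mem hc (.exMem hV (.const hc) (.exMem hV (.const hc)
      (.and (h.dfn_inUp hsub hV (.var _) (.const hxV)) (.and (h.dfn_inUp hsub hV (.var _)
        (.const hyV)) (.mem (.pair hV (.app hV (hsub h.add_mem) h.add_isFunc.isFunctional
          (.pair hV (.var _) (.var _))) (.var _)) (.const (hsub h.le_mem))))))))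
    ⟨fun t ht => (ZFSet.mem_sep.1 ht).1, fun t ht r hr htr => by
      obtain ⟨-, a, ha, b, hb, hax, hby, hle⟩ := ZFSet.mem_sep.1 ht
      exact ZFSet.mem_sep.2 ⟨hr, a, ha, b, hb, hax, hby, h.trans hle htr⟩⟩
  refine ⟨z, hz, fun t => (hzU t).trans ?_⟩
  rw [ZFSet.mem_sep, and_iff_right_iff_imp]
  rintro ⟨a, -, b, -, -, -, hle⟩
  exact (h.mem_of_le hle).2

theorem upMonoid_add_isFunc (h : W.IsDistanceMonoid V₀) (hsub : V₀ ⊆ V)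
    (hV : IsTransitiveModelZFC V) : ZFSet.IsFunc ((W.upCarrier V).prod (W.upCarrier V))
      (W.upCarrier V) (W.upMonoid V).add := by
  refine ⟨upAdd_subset, fun q hq => ?_⟩
  obtain ⟨x, hx, y, hy, rfl⟩ := ZFSet.mem_prod.1 hq
  obtain ⟨z, hz, hzt⟩ := h.exists_upMonoid_sum hsub hV hx hy
  refine ⟨z, pair_mem_upAdd.2 ⟨hx, hy, hz, fun t _ => hzt t⟩, fun z' hz' => ?_⟩
  obtain ⟨-, -, hz'', hzt'⟩ := pair_mem_upAdd.1 hz'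
  refine h.ext_inUp hz'' hz fun t => ?_
  by_cases ht : t ∈ W.carrier
  · rw [hzt' t ht, hzt t]
  · exact ⟨fun h' => absurd (h.mem_of_inUp hz'' h') ht, fun h' => absurd (h.mem_of_inUp hz h') ht⟩

theorem upMonoid_plus_mem (h : W.IsDistanceMonoid V₀) (hsub : V₀ ⊆ V)
    (hV : IsTransitiveModelZFC V) (hx : x ∈ W.upCarrier V) (hy : y ∈ W.upCarrier V) :
    (W.upMonoid V).plus x y ∈ W.upCarrier V :=
  (h.upMonoid_add_isFunc hsub hV).setApp_mem (ZFSet.pair_mem_prod.2 ⟨hx, hy⟩)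

theorem inUp_plus_iff (h : W.IsDistanceMonoid V₀) (hsub : V₀ ⊆ V)
    (hV : IsTransitiveModelZFC V) (hx : x ∈ W.upCarrier V) (hy : y ∈ W.upCarrier V) :
    W.InUp V t ((W.upMonoid V).plus x y) ↔
      ∃ a b, W.InUp V a x ∧ W.InUp V b y ∧ W.Le (W.plus a b) t := by
  have hxy : ZFSet.pair x y ∈ (W.upCarrier V).prod (W.upCarrier V) :=
    ZFSet.pair_mem_prod.2 ⟨hx, hy⟩
  have hspec := (h.upMonoid_add_isFunc hsub hV).setApp_spec hxy
  obtain ⟨-, -, hz, hzt⟩ := pair_mem_upAdd.1 hspec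
  constructor
  · intro ht
    obtain ⟨a, -, b, -, hab⟩ := (hzt t (h.mem_of_inUp hz ht)).1 ht
    exact ⟨a, b, hab⟩
  · rintro ⟨a, b, ha, hb, hab⟩
    exact (hzt t (h.mem_of_le hab).2).2 ⟨a, h.mem_of_inUp hx ha, b, h.mem_of_inUp hy hb, ha, hb, hab⟩

theorem upMonoid_le_of_le (h : W.IsDistanceMonoid V₀) (hab : W.Le a b) :
    (W.upMonoid V).Le a b := by
  obtain ⟨ha, hb⟩ := h.mem_of_le hab
  refine (h.upMonoid_le_iff (mem_upCarrier_of_mem ha) (mem_upCarrier_of_mem hb)).2 fun t ht => ?_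
  exact (inUp_of_mem ha).2 (h.trans hab ((inUp_of_mem hb).1 ht))

theorem upMonoid_plus_eq (h : W.IsDistanceMonoid V₀) (hsub : V₀ ⊆ V)
    (hV : IsTransitiveModelZFC V) (ha : a ∈ W.carrier) (hb : b ∈ W.carrier) :
    (W.upMonoid V).plus a b = W.plus a b := by
  have ha' := mem_upCarrier_of_mem (V := V) ha
  have hb' := mem_upCarrier_of_mem (V := V) hb
  have hab := h.plus_mem ha hb
  refine h.ext_inUp (h.upMonoid_plus_mem hsub hV ha' hb') (mem_upCarrier_of_mem hab) fun t => ?_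
  rw [h.inUp_plus_iff hsub hV ha' hb', inUp_of_mem hab]
  simp only [inUp_of_mem ha, inUp_of_mem hb]
  constructor
  · rintro ⟨p, q, hp, hq, hpq⟩
    exact h.trans (h.add_le_add' hp hq) hpq
  · exact fun ht => ⟨a, b, h.le_refl a ha, h.le_refl b hb, ht⟩

/-- The union of a family of upper sets is its meet. -/
theorem exists_upMonoid_meet (h : W.IsDistanceMonoid V₀) (hsub : V₀ ⊆ V)
    (hV : IsTransitiveModelZFC V) {A : ZFSet.{u}} (hA : A ∈ V) (hAC : A ⊆ W.upCarrier V) :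
    ∃ g, (W.upMonoid V).IsMeet {x | x ∈ A} g ∧ ∀ t, W.InUp V t g ↔ ∃ x ∈ A, W.InUp V t x := by
  have hc : W.carrier ∈ V := hsub h.carrier_mem
  obtain ⟨g, hg, hgU⟩ := h.exists_inUp_iff (V := V)
    (U := ZFSet.sep (fun t => ∃ x ∈ A, W.InUp V t x) W.carrier)
    (hV.sep_mem hc (.exMem hV (.const hA) (h.dfn_inUp hsub hV (.var _) (.var _))))
    ⟨fun t ht => (ZFSet.mem_sep.1 ht).1, fun t ht r hr htr => by
      obtain ⟨-, x, hx, htx⟩ := ZFSet.mem_sep.1 ht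
      exact ZFSet.mem_sep.2 ⟨hr, x, hx, h.inUp_mono (hAC hx) htx htr⟩⟩
  have hgA : ∀ t, W.InUp V t g ↔ ∃ x ∈ A, W.InUp V t x := fun t => (hgU t).trans <| by
    rw [ZFSet.mem_sep, and_iff_right_iff_imp]
    exact fun ⟨x, hx, htx⟩ => h.mem_of_inUp (hAC hx) htx
  refine ⟨g, ⟨hg, fun x hx => ?_, fun k hk hle => ?_⟩, hgA⟩
  · exact (h.upMonoid_le_iff hg (hAC hx)).2 fun t ht => (hgA t).2 ⟨x, hx, ht⟩
  · refine (h.upMonoid_le_iff hk hg).2 fun t ht => ?_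
    obtain ⟨x, hx, htx⟩ := (hgA t).1 ht
    exact (h.upMonoid_le_iff hk (hAC hx)).1 (hle x hx) t htx

/-- The intersection of a family of upper sets is its join. -/
theorem exists_upMonoid_join (h : W.IsDistanceMonoid V₀) (hsub : V₀ ⊆ V)
    (hV : IsTransitiveModelZFC V) {A : ZFSet.{u}} (hA : A ∈ V) (hAC : A ⊆ W.upCarrier V) :
    ∃ g, (W.upMonoid V).IsJoin {x | x ∈ A} g := by
  have hc : W.carrier ∈ V := hsub h.carrier_mem
  obtain ⟨g, hg, hgU⟩ := h.exists_inUp_iff (V := V)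
    (U := ZFSet.sep (fun t => ∀ x ∈ A, W.InUp V t x) W.carrier)
    (hV.sep_mem hc (.allMem hV (.const hA) (h.dfn_inUp hsub hV (.var _) (.var _))))
    ⟨fun t ht => (ZFSet.mem_sep.1 ht).1, fun t ht r hr htr =>
      ZFSet.mem_sep.2 ⟨hr, fun x hx => h.inUp_mono (hAC hx) ((ZFSet.mem_sep.1 ht).2 x hx) htr⟩⟩
  refine ⟨g, hg, fun x hx => ?_, fun k hk hle => ?_⟩
  · exact (h.upMonoid_le_iff (hAC hx) hg).2 fun t ht => (ZFSet.mem_sep.1 ((hgU t).1 ht)).2 x hx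
  · refine (h.upMonoid_le_iff hg hk).2 fun t ht => (hgU t).2 (ZFSet.mem_sep.2
      ⟨h.mem_of_inUp hk ht, fun x hx => ?_⟩)
    exact (h.upMonoid_le_iff (hAC hx) hk).1 (hle x hx) t ht

theorem upMonoid_isComplete (h : W.IsDistanceMonoid V₀) (hsub : V₀ ⊆ V)
    (hV : IsTransitiveModelZFC V) : (W.upMonoid V).IsComplete V := fun _ hA hAC =>
  ⟨let ⟨g, hg, _⟩ := h.exists_upMonoid_meet hsub hV hA hAC; ⟨g, hg⟩,
    h.exists_upMonoid_join hsub hV hA hAC⟩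

/-- Upper sets of a linear order are comparable by inclusion. Sums are generated elementwise and
meets are unions, so an element of z plus a meet already comes from z plus a single member of the
family; this gives `add_meet`. -/
theorem upMonoid_isDistanceMonoid (h : W.IsDistanceMonoid V₀) (hsub : V₀ ⊆ V)
    (hV : IsTransitiveModelZFC V) : (W.upMonoid V).IsDistanceMonoid V := by
  have hc : W.carrier ∈ V := hsub h.carrier_mem
  have hC := h.upCarrier_mem hsub hV
  have hplus : ∀ {x y}, x ∈ W.upCarrier V → y ∈ W.upCarrier V →
      (W.upMonoid V).plus x y ∈ W.upCarrier V := h.upMonoid_plus_mem hsub hV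
  have hin : ∀ {x y t}, x ∈ W.upCarrier V → y ∈ W.upCarrier V →
      (W.InUp V t ((W.upMonoid V).plus x y) ↔
        ∃ a b, W.InUp V a x ∧ W.InUp V b y ∧ W.Le (W.plus a b) t) := h.inUp_plus_iff hsub hV
  have hcomm : ∀ x ∈ W.upCarrier V, ∀ y ∈ W.upCarrier V,
      (W.upMonoid V).plus x y = (W.upMonoid V).plus y x := by
    intro x hx y hy
    refine h.ext_inUp (hplus hx hy) (hplus hy hx) fun t => ?_
    rw [hin hx hy, hin hy hx]
    constructor <;>
    · rintro ⟨a, b, ha, hb, hab⟩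
      refine ⟨b, a, hb, ha, ?_⟩
      rwa [h.add_comm _ (h.mem_of_inUp ‹_› hb) _ (h.mem_of_inUp ‹_› ha)]
  have hmono : ∀ x ∈ W.upCarrier V, ∀ y ∈ W.upCarrier V, ∀ z ∈ W.upCarrier V,
      (W.upMonoid V).Le x y → (W.upMonoid V).Le ((W.upMonoid V).plus z x)
        ((W.upMonoid V).plus z y) := by
    intro x hx y hy z hz hxy
    refine (h.upMonoid_le_iff (hplus hz hx) (hplus hz hy)).2 fun t ht => ?_
    obtain ⟨a, b, ha, hb, hab⟩ := (hin hz hy).1 ht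
    exact (hin hz hx).2 ⟨a, b, ha, (h.upMonoid_le_iff hx hy).1 hxy b hb, hab⟩
  refine
    { carrier_mem := hC
      add_mem := ?_
      zero_mem := hsub h.zero_mem
      le_mem := ?_
      add_isFunc := h.upMonoid_add_isFunc hsub hV
      zero_mem_carrier := mem_upCarrier_of_mem h.zero_mem_carrier
      le_subset := upLe_subset
      add_assoc := ?_
      add_comm := hcomm
      zero_add := ?_
      le_refl := fun x hx => (h.upMonoid_le_iff hx hx).2 fun _ => id
      le_antisymm := ?_
      le_trans := ?_
      le_total := ?_
      zero_le := ?_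
      add_le_add := ?_
      add_meet := ?_ }
  · change W.upAdd V ∈ V
    refine hV.sep_mem (hV.prod_mem (hV.prod_mem hC hC) hC) (.exMem hV (.const hC) (.exMem hV
      (.const hC) (.exMem hV (.const hC) (.and (.eq (.var _) (.pair hV (.pair hV (.var _) (.var _))
        (.var _))) (.allMem hV (.const hc) (.iff (h.dfn_inUp hsub hV (.var _) (.var _)) ?_))))))
    exact .exMem hV (.const hc) (.exMem hV (.const hc) (.and (h.dfn_inUp hsub hV (.var _) (.var _))
      (.and (h.dfn_inUp hsub hV (.var _) (.var _)) (.mem (.pair hV (.app hV (hsub h.add_mem)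
        h.add_isFunc.isFunctional (.pair hV (.var _) (.var _))) (.var _))
        (.const (hsub h.le_mem))))))
  · change W.upLe V ∈ V
    exact hV.sep_mem (hV.prod_mem hC hC) (.exMem hV (.const hC) (.exMem hV (.const hC) (.and
      (.eq (.var _) (.pair hV (.var _) (.var _))) (.allMem hV (.const hc) (.imp
        (h.dfn_inUp hsub hV (.var _) (.var _)) (h.dfn_inUp hsub hV (.var _) (.var _)))))))
  · intro x hx y hy z hz
    refine h.ext_inUp (hplus (hplus hx hy) hz) (hplus hx (hplus hy hz)) fun t => ?_
    rw [hin (hplus hx hy) hz, hin hx (hplus hy hz)]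
    constructor
    · rintro ⟨p, c, hp, hc, hpc⟩
      obtain ⟨a, b, ha, hb, hab⟩ := (hin hx hy).1 hp
      have ha' := h.mem_of_inUp hx ha
      have hb' := h.mem_of_inUp hy hb
      have hc' := h.mem_of_inUp hz hc
      refine ⟨a, W.plus b c, ha, (hin hy hz).2 ⟨b, c, hb, hc, h.le_refl _ (h.plus_mem hb' hc')⟩, ?_⟩
      rw [← h.add_assoc a ha' b hb' c hc']
      exact h.trans (h.add_le_add' hab (h.le_refl c hc')) hpc
    · rintro ⟨a, p, ha, hp, hap⟩
      obtain ⟨b, c, hb, hc, hbc⟩ := (hin hy hz).1 hp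
      have ha' := h.mem_of_inUp hx ha
      have hb' := h.mem_of_inUp hy hb
      have hc' := h.mem_of_inUp hz hc
      refine ⟨W.plus a b, c, (hin hx hy).2 ⟨a, b, ha, hb, h.le_refl _ (h.plus_mem ha' hb')⟩, hc, ?_⟩
      rw [h.add_assoc a ha' b hb' c hc']
      exact h.trans (h.add_le_add' (h.le_refl a ha') hbc) hap
  · intro x hx
    have h0 := mem_upCarrier_of_mem (V := V) h.zero_mem_carrier
    refine h.ext_inUp (hplus h0 hx) hx fun t => (hin h0 hx).trans ?_
    constructor
    · rintro ⟨a, b, ha, hb, hab⟩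
      exact h.inUp_mono hx hb (h.trans (h.le_add_left (h.mem_of_inUp hx hb)
        (h.mem_of_inUp h0 ha)) hab)
    · intro ht
      have ht' := h.mem_of_inUp hx ht
      refine ⟨W.zero, t, .inl (h.le_refl _ h.zero_mem_carrier), ht, ?_⟩
      rw [h.zero_add t ht']
      exact h.le_refl t ht'
  · intro x hx y hy hxy hyx
    exact h.ext_inUp hx hy fun t =>
      ⟨(h.upMonoid_le_iff hy hx).1 hyx t, (h.upMonoid_le_iff hx hy).1 hxy t⟩
  · intro x hx y hy z hz hxy hyz
    exact (h.upMonoid_le_iff hx hz).2 fun t ht =>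
      (h.upMonoid_le_iff hx hy).1 hxy t ((h.upMonoid_le_iff hy hz).1 hyz t ht)
  · intro x hx y hy
    rw [h.upMonoid_le_iff hx hy, h.upMonoid_le_iff hy hx]
    by_contra! hcon
    obtain ⟨⟨t, hty, htx⟩, r, hrx, hry⟩ := hcon
    rcases h.le_total t (h.mem_of_inUp hy hty) r (h.mem_of_inUp hx hrx) with htr | hrt
    · exact hry (h.inUp_mono hy hty htr)
    · exact htx (h.inUp_mono hx hrx hrt)
  · intro x hx
    exact (h.upMonoid_le_iff (mem_upCarrier_of_mem h.zero_mem_carrier) hx).2 fun t ht =>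
      .inl (h.zero_le t (h.mem_of_inUp hx ht))
  · intro x hx y hy z hz hxy
    have := hmono x hx y hy z hz hxy
    exact ⟨this, hcomm z hz x hx ▸ hcomm z hz y hy ▸ this⟩
  · intro A hA hAC z hz g hg
    obtain ⟨g', hg', hgA⟩ := h.exists_upMonoid_meet hsub hV hA hAC
    have hgC : g ∈ W.upCarrier V := hg.1
    have hgg' : ∀ t, W.InUp V t g → ∃ x ∈ A, W.InUp V t x := fun t ht =>
      (hgA t).1 ((h.upMonoid_le_iff hg'.1 hg.1).1 (hg.2.2 g' hg'.1 hg'.2.1) t ht)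
    refine ⟨hplus hz hgC, ?_, fun k hk hle => ?_⟩
    · rintro _ ⟨x, hx, rfl⟩
      rw [hcomm x (hAC hx) z hz]
      exact hmono g hgC x (hAC hx) z hz (hg.2.1 x hx)
    · refine (h.upMonoid_le_iff hk (hplus hz hgC)).2 fun t ht => ?_
      obtain ⟨a, b, ha, hb, hab⟩ := (hin hz hgC).1 ht
      obtain ⟨x, hx, hbx⟩ := hgg' b hb
      have hkx := hle _ ⟨x, hx, rfl⟩
      rw [hcomm x (hAC hx) z hz, h.upMonoid_le_iff hk (hplus hz (hAC hx))] at hkx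
      exact hkx t ((hin hz (hAC hx)).2 ⟨a, b, ha, hbx, hab⟩)

/-- The positive elements have a least one. -/
theorem exists_upMonoid_least_pos (h : W.IsDistanceMonoid V₀) (hsub : V₀ ⊆ V)
    (hV : IsTransitiveModelZFC V) : ∃ m ∈ (W.upMonoid V).pos, ∀ x ∈ (W.upMonoid V).pos,
      (W.upMonoid V).Le m x := by
  have hc : W.carrier ∈ V := hsub h.carrier_mem
  have h0 := mem_upCarrier_of_mem (V := V) h.zero_mem_carrier
  obtain ⟨m, hm, hmU⟩ := h.exists_inUp_iff (V := V) (U := W.pos)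
    (hV.sep_mem hc (.not (.eq (.var _) (.const (hsub h.zero_mem)))))
    ⟨fun t ht => (mem_pos.1 ht).1, fun t ht r hr htr => mem_pos.2 ⟨hr, fun hr0 =>
      (mem_pos.1 ht).2 (h.eq_zero_of_le (hr0 ▸ htr))⟩⟩
  refine ⟨m, mem_pos.2 ⟨hm, ?_⟩, fun x hx => ?_⟩
  · rintro rfl
    exact (mem_pos.1 ((hmU W.zero).1 (.inl (h.le_refl _ h.zero_mem_carrier)))).2 rfl
  · obtain ⟨hxC, hx0⟩ := mem_pos.1 hx
    refine (h.upMonoid_le_iff hm hxC).2 fun t ht => (hmU t).2 (mem_pos.2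
      ⟨h.mem_of_inUp hxC ht, ?_⟩)
    -- An upper set that contains 0 is all of W and is therefore coded by 0, so the others lie
    -- within W⁺.
    rintro rfl
    refine hx0 (h.ext_inUp hxC h0 fun t => ⟨fun ht' => ?_, fun ht' => ?_⟩)
    · exact .inl (h.zero_le t (h.mem_of_inUp hxC ht'))
    · exact h.inUp_mono hxC ht ((inUp_of_mem h.zero_mem_carrier).1 ht')

end IsDistanceMonoid

end DMon

/-! ### The system over the upper sets, and minimal relativizations. -/

namespace GDS

open DMon

variable {V V₀ : Set ZFSet.{u}} {S N : GDS.{u}}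

/-- Over a distance monoid with a least positive element there are no Cauchy sequences. -/
theorem not_isCauchySeq_of_least_pos (h : S.toDMon.IsDistanceMonoid V) {m : ZFSet.{u}}
    (hm : m ∈ S.pos) (hleast : ∀ x ∈ S.pos, S.Le m x) {A p : ZFSet.{u}} :
    ¬ S.IsCauchySeq V A p := by
  intro hp
  obtain ⟨hmc, hm0⟩ := mem_pos.1 hm
  refine hm0 (h.eq_zero_of_le (hp.meet_eq.2.2 m hmc ?_))
  rintro _ ⟨a, ha, b, hb, rfl⟩
  have ha' := hp.subset ha
  exact h.trans (hleast a ha')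
    (h.le_add_right (mem_pos.1 ha').1 (mem_pos.1 (hp.subset hb)).1)

/-- The same points, with distances regarded as principal upper sets. -/
noncomputable def upSystem (V : Set ZFSet.{u}) (S : GDS.{u}) : GDS.{u} where
  toDMon := S.toDMon.upMonoid V
  pts := S.pts
  dist := S.dist
  map := S.map

/-- V may contain new Cauchy sequences over W without a limit among the old points. Over the upper
sets they are no longer Cauchy sequences, since W⁺ separates 0 from all other distances, so no
points need to be added. -/
theorem IsGDS.upSystem_isGDS (h : S.IsGDS V₀) (hsub : V₀ ⊆ V) (hV : IsTransitiveModelZFC V) :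
    (S.upSystem V).IsGDS V := by
  have hW := h.isDistanceMonoid
  have hM := h.isMetricSpace
  have hW' : (S.upSystem V).toDMon.IsDistanceMonoid V := hW.upMonoid_isDistanceMonoid hsub hV
  refine
    { isDistanceMonoid := hW'
      isComplete := hW.upMonoid_isComplete hsub hV
      isMetricSpace :=
        { pts_mem := hsub hM.pts_mem
          dist_mem := hsub hM.dist_mem
          dist_isFunc := ⟨fun q hq => ?_, hM.dist_isFunc.2⟩
          eq_iff := hM.eq_iff
          triangle := fun x hx y hy z hz => ?_ }
      cauchyComplete := fun A p hp => ?_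
      map_mem := hsub h.map_mem
      map_isFunc := h.map_isFunc
      nonexpanding := fun x hx y hy => hW.upMonoid_le_of_le (h.nonexpanding x hx y hy) }
  · obtain ⟨r, hr, e, he, rfl⟩ := ZFSet.mem_prod.1 (hM.dist_isFunc.1 hq)
    exact ZFSet.pair_mem_prod.2 ⟨hr, IsDistanceMonoid.mem_upCarrier_of_mem he⟩
  · have := hW.upMonoid_le_of_le (V := V) (hM.triangle x hx y hy z hz)
    rwa [← hW.upMonoid_plus_eq hsub hV (hM.d_mem hx hy) (hM.d_mem hy hz)] at this
  · obtain ⟨m, hm, hleast⟩ := hW.exists_upMonoid_least_pos hsub hV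
    exact absurd hp (not_isCauchySeq_of_least_pos hW' hm hleast)

theorem IsGDS.isSubstructure_upSystem (h : S.IsGDS V₀) (hsub : V₀ ⊆ V)
    (hV : IsTransitiveModelZFC V) : S.IsSubstructure (S.upSystem V) where
  carrier_subset _ ha := IsDistanceMonoid.mem_upCarrier_of_mem ha
  pts_subset _ hx := hx
  zero_eq := rfl
  plus_eq _ ha _ hb := h.isDistanceMonoid.upMonoid_plus_eq hsub hV ha hb
  le_of_le _ _ _ _ hab := h.isDistanceMonoid.upMonoid_le_of_le hab
  d_eq _ _ _ _ := rfl
  f_eq _ _ := rfl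

theorem IsHom.hasFixedPoint {i j : ZFSet.{u}} (h : S.IsHom N i j) (hfix : S.HasFixedPoint) :
    N.HasFixedPoint := by
  obtain ⟨x, hx, hfx⟩ := hfix
  exact ⟨setApp j x, h.isFunc_right.setApp_mem hx, by rw [← h.f x hx, hfx]⟩

theorem IsSubstructure.hasFixedPoint (h : S.IsSubstructure N) (hfix : S.HasFixedPoint) :
    N.HasFixedPoint := by
  obtain ⟨x, hx, hfx⟩ := hfix
  exact ⟨x, h.pts_subset hx, (h.f_eq x hx).trans hfx⟩

/-- By minimality a relativization maps to the system over the upper sets, whose points are those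
of the ground model. -/
theorem IsRelativization.hasFixedPoint (hV : IsTransitiveModelZFC V) (hsub : V₀ ⊆ V)
    (hS : S.IsGDS V₀) (h : S.IsRelativization V N) (hfix : N.HasFixedPoint) :
    S.HasFixedPoint := by
  obtain ⟨i, -, j, -, hij, -⟩ := h.minimal _ (hS.upSystem_isGDS hsub hV)
    (hS.isSubstructure_upSystem hsub hV)
  exact hij.hasFixedPoint hfix

end GDS

theorem mainTheorem1 (V₀ V₁ : Set ZFSet.{u})
    (hV₀ : IsTransitiveModelZFC V₀) (hV₁ : IsTransitiveModelZFC V₁) (hV : V₀ ⊆ V₁)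
    (S₀ : GDS.{u}) (hS₀ : S₀.IsGDS V₀)
    (hcont : S₀.toDMon.IsContinuous V₀)
    (hcoinit : S₀.toDMon.IsCoinitiality V₀ ZFSet.omega.{u})
    (S₁ : GDS.{u})
    (hS₁ : S₀.IsCompletionOf V₁ S₁ ∨ S₀.IsRelativization V₁ S₁) :
    S₀.HasFixedPoint ↔ S₁.HasFixedPoint := by
  obtain ⟨-, ⟨s, hs⟩, -⟩ := hcoinit
  rcases hS₁ with h | h
  · exact ⟨h.isSubstructure.hasFixedPoint, h.hasFixedPoint hV₀ hV₁ hS₀ hcont.2.2 hs⟩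
  · exact ⟨h.isSubstructure.hasFixedPoint, h.hasFixedPoint hV₁ hV hS₀⟩
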